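/- Let $d\ge 1$. For $f,g\in L^2(\mathbb R^d)$ let $W(f,g)(x,\xi)=\int_{\mathbb R^d}f(x+\tfrac t2)\overline{g(x-\tfrac t2)}e^{-2\pi i\xi\cdot t}\,dt$, $(x,\xi)\in\mathbb R^{2d}$, be the cross-Wigner distribution. Let $\vartheta=(\vartheta_1,\dots,\vartheta_d)\in\mathbb R^d$ and let $\mathcal F_\vartheta$ be a fractional Fourier transform, i.e. a metaplectic operator with projection $$S_\vartheta=\begin{pmatrix}\operatorname{diag}(\cos\vartheta_j)&\operatorname{diag}(\sin\vartheta_j)\\-\operatorname{diag}(\sin\vartheta_j)&\operatorname{diag}(\cos\vartheta_j)\end{pmatrix},$$ which means that $\mathcal F_\vartheta$ is a unitary operator on $L^2(\mathbb R^d)$ with $W(\mathcal F_\vartheta f,\mathcal F_\vartheta g)(z)=W(f,g)(S_\vartheta^{-1}z)$ for all $f,g\in L^2(\mathbb R^d)$ and $z\in\mathbb R^{2d}$ (this determines $\mathcal F_\vartheta$ up to a constant factor of modulus one). Put $\mathcal J=\{j:\sin\vartheta_j\ne0\}$, $\mathcal J^c=\{1,\dots,d\}\setminus\mathcal J$, and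 assume $\mathcal J\neq\emptyset$. For $x\in\mathbb R^d$ write $x_{\mathcal J}=(x_j)_{j\in\mathcal J}\in\mathbb R^{\mathcal J}$ and $x_{\mathcal J^c}=(x_j)_{j\in\mathcal J^c}\in\mathbb R^{\mathcal J^c}$. Let $a,b>0$ and let $f\in L^2(\mathbb R^d)\setminus\{0\}$ satisfy $$|f(x)|\le\alpha(x_{\mathcal J^c})\,e^{-\pi a|x_{\mathcal J}|^2}\quad\text{for a.e. }x\in\mathbb R^d,\qquad |\mathcal F_\vartheta f(\xi)|\le\beta(\xi_{\mathcal J^c})\,e^{-\pi b|\xi_{\mathcal J}|^2}\quad\text{for a.e. }\xi\in\mathbb R^d,$$ for some functions $\alpha,\beta:\mathbb R^{\mathcal J^c}\to(0,+\infty)$. Then: (i) $ab\sin^2\vartheta_j\le1$ for every $1\le j\le d$. (ii) If $\sin^2\vartheta_j=1/(ab)$ for every $j\in\mathcal J$, then there is $\gamma\in L^2(\mathbb R^{\mathcal J^c})$ such that $$f(x)=\gamma(x_{\mathcal J^c})\prod_{j\in\mathcal J}e^{-\pi(a+i\cot\vartheta_j)x_j^2}\qquad\text{for a.e. }x\in\mathbb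 R^d.$$ (If $\mathcal J^c=\emptyset$, then $\mathbb R^{\mathcal J^c}$ is a point and $\alpha,\beta,\gamma$ are constants.) -/

import Mathlib

open MeasureTheory

noncomputable section

namespace FracFourierHardy

/-- `L²(ℝᵈ; ℂ)` with respect to Lebesgue measure. -/
abbrev L2 (d : ℕ) : Type :=
  Lp ℂ 2 (volume : Measure (EuclideanSpace ℝ (Fin d)))

/-- The cross-Wigner distribution
`W(f,g)(x,ξ) = ∫ f(x + t/2) conj(g(x - t/2)) e^{-2πi ξ·t} dt`. -/
def crossWigner {d : ℕ} (f g : EuclideanSpace ℝ (Fin d) → ℂ)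
    (x ξ : EuclideanSpace ℝ (Fin d)) : ℂ :=
  ∫ t : EuclideanSpace ℝ (Fin d),
    f (x + (1 / 2 : ℝ) • t) * (starRingEnd ℂ) (g (x - (1 / 2 : ℝ) • t)) *
      Complex.exp (-2 * Real.pi * Complex.I * (inner ℝ ξ t : ℝ))

/-- The position component `x` of a phase-space point `z = (x, ξ)`. -/
def pos {d : ℕ} (z : Fin d ⊕ Fin d → ℝ) : EuclideanSpace ℝ (Fin d) :=
  WithLp.toLp 2 fun j => z (Sum.inl j)

/-- The momentum component `ξ` of a phase-space point `z = (x, ξ)`. -/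
def mom {d : ℕ} (z : Fin d ⊕ Fin d → ℝ) : EuclideanSpace ℝ (Fin d) :=
  WithLp.toLp 2 fun j => z (Sum.inr j)

/-- The unitary operator `U` on `L²(ℝᵈ)` is a metaplectic operator with projection the symplectic
matrix `S`: `W(Uf, Ug)(z) = W(f, g)(S⁻¹ z)` for all `f, g ∈ L²(ℝᵈ)` and all `z ∈ ℝ²ᵈ`.
(This determines `U` up to a constant factor of modulus one.) -/
def IsMetaplectic {d : ℕ} (S : Matrix.symplecticGroup (Fin d) ℝ) (U : L2 d ≃ₗᵢ[ℂ] L2 d) : Prop :=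
  ∀ (f g : L2 d) (z : Fin d ⊕ Fin d → ℝ),
    crossWigner (U f) (U g) (pos z) (mom z) =
      crossWigner f g
        (pos (Matrix.mulVec (S : Matrix (Fin d ⊕ Fin d) (Fin d ⊕ Fin d) ℝ)⁻¹ z))
        (mom (Matrix.mulVec (S : Matrix (Fin d ⊕ Fin d) (Fin d ⊕ Fin d) ℝ)⁻¹ z))

/-- The matrix `S_θ` with blocks `A = D = diag(cos θ_j)`, `B = diag(sin θ_j)`, `C = -B`. -/
def fracMatrix {d : ℕ} (θ : Fin d → ℝ) : Matrix (Fin d ⊕ Fin d) (Fin d ⊕ Fin d) ℝ :=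
  Matrix.fromBlocks
    (Matrix.diagonal fun j => Real.cos (θ j)) (Matrix.diagonal fun j => Real.sin (θ j))
    (-Matrix.diagonal fun j => Real.sin (θ j)) (Matrix.diagonal fun j => Real.cos (θ j))

theorem fracMatrix_mem {d : ℕ} (θ : Fin d → ℝ) :
    fracMatrix θ ∈ Matrix.symplecticGroup (Fin d) ℝ := by
  have h : ∀ x : ℝ, Real.cos x * Real.cos x + Real.sin x * Real.sin x = 1 := fun x => by
    nlinarith [Real.sin_sq_add_cos_sq x]
  rw [SymplecticGroup.mem_iff]
  unfold fracMatrix Matrix.J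
  simp only [Matrix.fromBlocks_transpose, Matrix.fromBlocks_multiply, Matrix.diagonal_transpose,
    Matrix.transpose_neg, Matrix.mul_zero, Matrix.mul_one, Matrix.mul_neg, Matrix.neg_mul,
    Matrix.diagonal_mul_diagonal, zero_add, add_zero, neg_neg]
  congr 1 <;> ext i j <;> by_cases hij : i = j <;>
    simp [Matrix.diagonal, Matrix.one_apply, hij] <;> linarith [h (θ j)]

/-- `S_θ` as an element of the symplectic group. -/
def fracSymplectic {d : ℕ} (θ : Fin d → ℝ) : Matrix.symplecticGroup (Fin d) ℝ :=
  ⟨fracMatrix θ, fracMatrix_mem θ⟩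

/-- `U` is a fractional Fourier transform `F_θ`: a metaplectic operator with projection `S_θ`. -/
def IsFracFourier {d : ℕ} (θ : Fin d → ℝ) (U : L2 d ≃ₗᵢ[ℂ] L2 d) : Prop :=
  IsMetaplectic (fracSymplectic θ) U

/-- The index set `𝒥 = {j : sin θ_j ≠ 0}`. -/
def sinIdx {d : ℕ} (θ : Fin d → ℝ) : Finset (Fin d) :=
  Finset.univ.filter fun j => Real.sin (θ j) ≠ 0

/-- The coordinates of `x` indexed by `s`; the coordinate subspace
`Γ_s = {x ∈ ℝᵈ : x_j = 0 for j ∉ s}` is identified with `ℝˢ`. -/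
def coords {d : ℕ} (s : Finset (Fin d)) (x : EuclideanSpace ℝ (Fin d)) : EuclideanSpace ℝ s :=
  WithLp.toLp 2 fun j => x j

end FracFourierHardy

end

open MeasureTheory FracFourierHardy

/-!
Multiplying `f` and `F_θ f` by chirps and dilating turns `F_θ` into the Fourier transform in the
variables `x_J`, up to reflections of the others; both Gaussian bounds survive, the second with
rates multiplied by `sin² θ_j`. Everything is read off the Wigner distribution, since `F_θ` is only
known through it. Let `H` and `G` be the transformed `f` and `F_θ f`. Inverting the Fourier
transform in the momentum variables, the covariance relation becomes
`G(ξ, y) conj G(ξ', y') = N 𝓕H(·, y)(ξ) conj 𝓕H(·, y')(ξ')` almost everywhere, so for almost every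
`y` the function `𝓕H(·, y)` is a multiple of `G(·, y)` and inherits its decay.

Each slice is then a case of Hardy's theorem. The Fourier transform of a function bounded by a
multiple of `exp (-π a |x|²)` extends along every line to an entire function bounded by a multiple
of `exp (π / a (Im z)²)`; if on the real line it is bounded by a multiple of `exp (-π / a x²)`,
Phragmén–Lindelöf forces it to be a multiple of `exp (-π / a z²)`. A faster decay on the line makes
that multiple zero.
-/

namespace FracFourierHardy

open Filter Complex
open scoped Topology Real FourierTransform SchwartzMap ComplexConjugate RealInnerProductSpace

section PhragmenLindelof

theorem norm_le_of_sector {E : Type*} [NormedAddCommGroup E] [NormedSpace ℂ E] {f : ℂ → E}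
    {φ A B C c : ℝ} (hφ : 0 < φ) (hφπ : φ ≤ π)
    (hf : DiffContOnCl ℂ f {z | z.arg ∈ Set.Ioo 0 φ}) (hc : 0 ≤ c) (hcφ : c < π / φ)
    (hgrow : ∀ z : ℂ, z.arg ∈ Set.Ioo 0 φ → ‖f z‖ ≤ A * Real.exp (B * ‖z‖ ^ c))
    (hlow : ∀ r : ℝ, 0 ≤ r → ‖f r‖ ≤ C) (hupp : ∀ r : ℝ, 0 ≤ r → ‖f (r * cexp (φ * I))‖ ≤ C)
    {z : ℂ} (hz : z.arg ∈ Set.Icc 0 φ) : ‖f z‖ ≤ C := by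
  rcases eq_or_ne z 0 with rfl | hz0
  · simpa using hlow 0 le_rfl
  have arg_exp_mem : Set.MapsTo cexp (im ⁻¹' Set.Ioo 0 φ) {z | z.arg ∈ Set.Ioo 0 φ} := by
    intro w hw
    have hwim : w.im ∈ Set.Ioc (-π) π :=
      ⟨by linarith [hw.1, Real.pi_pos], hw.2.le.trans hφπ⟩
    simpa [arg_exp, (toIocMod_eq_self Real.two_pi_pos).2
      (show w.im ∈ Set.Ioc (-π) (-π + 2 * π) by convert hwim using 2; ring)]
      using hw
  have exp_eq (w : ℂ) : cexp w = Real.exp w.re * cexp (w.im * I) := by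
    rw [ofReal_exp, ← Complex.exp_add, re_add_im]
  have strip := PhragmenLindelof.horizontal_strip (a := 0) (b := φ) (C := C) (z := log z)
    (f := f ∘ cexp) (hf.comp differentiable_exp.diffContOnCl arg_exp_mem)
    ⟨c, by rwa [sub_zero], |B|, .of_bound A ?_⟩
    (fun w hw => by simpa [exp_eq w, hw] using hlow _ (Real.exp_nonneg w.re))
    (fun w hw => by simpa [exp_eq w, hw] using hupp _ (Real.exp_nonneg w.re))
    (by simpa only [log_im] using hz.1) (by simpa only [log_im] using hz.2)
  · simpa [Complex.exp_log hz0] using strip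
  rw [eventually_inf_principal]
  refine .of_forall fun w hw => ?_
  have hA : 0 ≤ A :=
    nonneg_of_mul_nonneg_left ((norm_nonneg _).trans (hgrow _ (arg_exp_mem hw))) (Real.exp_pos _)
  rw [Real.norm_of_nonneg (Real.exp_nonneg _)]
  refine (hgrow _ (arg_exp_mem hw)).trans ?_
  rw [norm_exp, ← Real.exp_mul, mul_comm w.re]
  gcongr
  · exact le_abs_self B
  · exact le_abs_self w.re

theorem norm_cexp_mul_I_mul_sq (δ : ℝ) (z : ℂ) :
    ‖cexp (δ * I * z ^ 2)‖ = Real.exp (-(2 * δ * z.re * z.im)) := by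
  rw [norm_exp]
  congr 1
  simp [pow_two]
  ring

theorem norm_cexp_mul_sq (B : ℝ) (z : ℂ) :
    ‖cexp (B * z ^ 2)‖ = Real.exp (B * z.re ^ 2 - B * z.im ^ 2) := by
  rw [norm_exp]
  congr 1
  simp [pow_two]
  ring

theorem norm_mul_cexp_le_of_mul_re_le {ψ : ℂ → ℂ} {B C δ : ℝ} (hC : 0 ≤ C) {z : ℂ}
    (hgrow : ‖ψ z‖ ≤ C * Real.exp (B * z.re ^ 2)) (hre : 0 ≤ z.re)
    (hray : B * z.re ≤ 2 * δ * z.im) : ‖ψ z * cexp (δ * I * z ^ 2)‖ ≤ C := by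
  rw [norm_mul, norm_cexp_mul_I_mul_sq]
  calc ‖ψ z‖ * Real.exp (-(2 * δ * z.re * z.im))
      ≤ C * Real.exp (B * z.re ^ 2) * Real.exp (-(2 * δ * z.re * z.im)) := by gcongr
    _ = C * Real.exp (z.re * (B * z.re - 2 * δ * z.im)) := by
        rw [mul_assoc, ← Real.exp_add]; ring_nf
    _ ≤ C * 1 := by
        gcongr
        exact Real.exp_le_one_iff.2 (mul_nonpos_of_nonneg_of_nonpos hre (by linarith))
    _ = C := mul_one C

-- The damping factor beats the growth above the ray `2δ im z = B re z`; the sector below this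
-- ray has opening less than `π/2`, so Phragmén–Lindelöf admits growth of order two there.
theorem norm_mul_cexp_le_of_quadrant {ψ : ℂ → ℂ} (hψ : Differentiable ℂ ψ) {B C δ : ℝ}
    (hB : 0 < B) (hδ : 0 < δ) (hgrow : ∀ z : ℂ, ‖ψ z‖ ≤ C * Real.exp (B * z.re ^ 2))
    (hreal : ∀ x : ℝ, ‖ψ x‖ ≤ C) {z : ℂ} (hre : 0 ≤ z.re) (him : 0 ≤ z.im) :
    ‖ψ z * cexp (δ * I * z ^ 2)‖ ≤ C := by
  have hC : 0 ≤ C := (norm_nonneg _).trans (hreal 0)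
  by_cases hray : B * z.re ≤ 2 * δ * z.im
  · exact norm_mul_cexp_le_of_mul_re_le hC (hgrow z) hre hray
  set φ := Real.arctan (B / (2 * δ))
  have hφ : 0 < φ := Real.arctan_pos.2 (by positivity)
  have hφ' : φ < π / 2 := Real.arctan_lt_pi_div_two _
  have hzre : 0 < z.re := hre.lt_of_ne fun h => hray (by rw [← h]; nlinarith)
  have hzarg : z.arg ≤ φ := by
    have harg := abs_lt.1 (abs_arg_lt_pi_div_two_iff.2 (.inl hzre))
    rw [← Real.arctan_tan harg.1 harg.2, tan_arg]
    refine Real.arctan_strictMono.monotone ((div_le_div_iff₀ hzre (by positivity)).2 ?_)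
    linarith
  refine norm_le_of_sector (f := fun w => ψ w * cexp (δ * I * w ^ 2)) (A := C) (B := B) (c := 2)
    hφ (by linarith [Real.pi_pos]) (Differentiable.diffContOnCl (by fun_prop)) zero_le_two
    (by rw [lt_div_iff₀ hφ]; linarith) (fun w hw => ?_) (fun r _ => ?_) (fun r hr => ?_)
    ⟨arg_nonneg_iff.2 him, hzarg⟩
  · have hwim : 0 ≤ w.im := arg_nonneg_iff.1 hw.1.le
    have hwre : 0 ≤ w.re :=
      abs_arg_le_pi_div_two_iff.1 (abs_le.2 ⟨by linarith [hw.1], by linarith [hw.2]⟩)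
    rw [norm_mul, norm_cexp_mul_I_mul_sq, Real.rpow_two]
    calc ‖ψ w‖ * Real.exp (-(2 * δ * w.re * w.im)) ≤ C * Real.exp (B * w.re ^ 2) * 1 := by
          gcongr
          · exact hgrow w
          · exact Real.exp_le_one_iff.2 (neg_nonpos.2 (by positivity))
      _ ≤ C * Real.exp (B * ‖w‖ ^ 2) := by
          rw [mul_one]; gcongr; exact re_le_norm w
  · rw [norm_mul, norm_cexp_mul_I_mul_sq]
    simpa using hreal r
  · have hcos : 0 < Real.cos φ := Real.cos_arctan_pos _
    have hsin : Real.sin φ = B / (2 * δ) * Real.cos φ := by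
      rw [← Real.tan_mul_cos hcos.ne', Real.tan_arctan]
    have hre' : (r * cexp (φ * I)).re = r * Real.cos φ := by simp [exp_ofReal_mul_I_re]
    have him' : (r * cexp (φ * I)).im = r * Real.sin φ := by simp [exp_ofReal_mul_I_im]
    refine norm_mul_cexp_le_of_mul_re_le hC (hgrow _) (by rw [hre']; positivity) (le_of_eq ?_)
    rw [hre', him', hsin]
    field_simp

theorem norm_le_of_quadrant {ψ : ℂ → ℂ} (hψ : Differentiable ℂ ψ) {B C : ℝ} (hB : 0 < B)
    (hgrow : ∀ z : ℂ, ‖ψ z‖ ≤ C * Real.exp (B * z.re ^ 2)) (hreal : ∀ x : ℝ, ‖ψ x‖ ≤ C)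
    {z : ℂ} (hre : 0 ≤ z.re) (him : 0 ≤ z.im) : ‖ψ z‖ ≤ C := by
  have hlim : Tendsto (fun δ : ℝ => ‖ψ z * cexp (δ * I * z ^ 2)‖) (𝓝[>] 0) (𝓝 ‖ψ z‖) := by
    have hcont : Continuous fun δ : ℝ => ‖ψ z * cexp (δ * I * z ^ 2)‖ := by fun_prop
    simpa using (hcont.tendsto 0).mono_left nhdsWithin_le_nhds
  refine le_of_tendsto hlim ?_
  filter_upwards [self_mem_nhdsWithin] with δ hδ
  exact norm_mul_cexp_le_of_quadrant hψ hB hδ hgrow hreal hre him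

theorem norm_le_of_norm_le_exp_re_sq {ψ : ℂ → ℂ} (hψ : Differentiable ℂ ψ) {B C : ℝ} (hB : 0 < B)
    (hgrow : ∀ z : ℂ, ‖ψ z‖ ≤ C * Real.exp (B * z.re ^ 2)) (hreal : ∀ x : ℝ, ‖ψ x‖ ≤ C)
    (z : ℂ) : ‖ψ z‖ ≤ C := by
  wlog hre : 0 ≤ z.re generalizing ψ z
  · simpa using this (ψ := fun w => ψ (-w)) (by fun_prop) (fun w => by simpa using hgrow (-w))
      (fun x => by simpa using hreal (-x)) (-z) (by simpa using (not_le.1 hre).le)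
  wlog him : 0 ≤ z.im generalizing ψ z
  · have hψ' : Differentiable ℂ fun w => conj (ψ (conj w)) := fun w => by
      simpa [Function.comp_def] using (hψ (conj w)).conj_conj
    simpa using this hψ' (fun w => by simpa using hgrow (conj w)) (fun x => by simpa using hreal x)
      (conj z) (by simpa using hre) (by simpa using (not_le.1 him).le)
  exact norm_le_of_quadrant hψ hB hgrow hreal hre him

theorem eq_gaussian_of_entire_bounds {φ : ℂ → ℂ} (hφ : Differentiable ℂ φ) {B C : ℝ} (hB : 0 < B)
    (hgrow : ∀ z : ℂ, ‖φ z‖ ≤ C * Real.exp (B * z.im ^ 2))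
    (hreal : ∀ x : ℝ, ‖φ x‖ ≤ C * Real.exp (-B * x ^ 2)) (z : ℂ) :
    φ z = φ 0 * cexp (-B * z ^ 2) := by
  have hbound (z : ℂ) : ‖φ z * cexp (B * z ^ 2)‖ ≤ C := by
    refine norm_le_of_norm_le_exp_re_sq (ψ := fun z => φ z * cexp (B * z ^ 2)) (by fun_prop) hB
      (fun z => ?_) (fun x => ?_) z
    · rw [norm_mul, norm_cexp_mul_sq]
      calc ‖φ z‖ * Real.exp (B * z.re ^ 2 - B * z.im ^ 2)
          ≤ C * Real.exp (B * z.im ^ 2) * Real.exp (B * z.re ^ 2 - B * z.im ^ 2) := by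
            gcongr; exact hgrow z
        _ = C * Real.exp (B * z.re ^ 2) := by rw [mul_assoc, ← Real.exp_add]; ring_nf
    · rw [norm_mul, norm_cexp_mul_sq]
      calc ‖φ x‖ * Real.exp (B * (x : ℂ).re ^ 2 - B * (x : ℂ).im ^ 2)
          ≤ C * Real.exp (-B * x ^ 2) * Real.exp (B * (x : ℂ).re ^ 2 - B * (x : ℂ).im ^ 2) := by
            gcongr; exact hreal x
        _ = C := by rw [mul_assoc, ← Real.exp_add]; simp
  have hconst : φ z * cexp (B * z ^ 2) = φ 0 * cexp (B * 0 ^ 2) :=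
    Differentiable.apply_eq_apply_of_bounded (f := fun z => φ z * cexp (B * z ^ 2)) (by fun_prop)
      (isBounded_iff_forall_norm_le.2 ⟨C, by rintro _ ⟨w, rfl⟩; exact hbound w⟩) z 0
  calc φ z = φ z * cexp (B * z ^ 2) * cexp (-B * z ^ 2) := by
        rw [mul_assoc, ← Complex.exp_add]; simp
    _ = φ 0 * cexp (-B * z ^ 2) := by rw [hconst]; simp

end PhragmenLindelof

section Fourier

variable {V : Type*} [NormedAddCommGroup V] [InnerProductSpace ℝ V] [FiniteDimensional ℝ V]
  [MeasurableSpace V] [BorelSpace V]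

theorem continuous_fourier {h : V → ℂ} (hh : Integrable h) : Continuous (𝓕 h) :=
  VectorFourier.fourierIntegral_continuous Real.continuous_fourierChar
    (by exact continuous_inner) hh

theorem fourier_const_mul (N : ℂ) (h : V → ℂ) (ξ : V) : 𝓕 (fun v => N * h v) ξ = N * 𝓕 h ξ := by
  simp only [Real.fourier_eq, ← integral_const_mul, mul_smul_comm]

theorem integral_fourier_mul_eq {u v : V → ℂ} (hu : Integrable u) (hv : Integrable v) :
    ∫ ξ, 𝓕 u ξ * v ξ = ∫ x, u x * 𝓕 v x := by
  have h := VectorFourier.integral_fourierIntegral_smul_eq_flip (μ := (volume : Measure V))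
    (ν := (volume : Measure V)) (L := innerₗ V) Real.continuous_fourierChar continuous_inner hu hv
  rwa [flip_innerₗ] at h

-- A test function is the Fourier transform of a Schwartz function, so moving `𝓕` across the
-- duality pairing reduces the claim to inversion on the Schwartz space.
theorem ae_eq_fourierInv_fourier {h : V → ℂ} (hh : Integrable h) (hFh : Integrable (𝓕 h)) :
    h =ᵐ[volume] 𝓕⁻ (𝓕 h) := by
  have hcont : Continuous (𝓕⁻ (𝓕 h)) := by
    rw [Real.fourierInv_eq_fourier_comp_neg]
    exact continuous_fourier hFh.comp_neg
  refine ae_eq_of_integral_contDiff_smul_eq hh.locallyIntegrable hcont.locallyIntegrable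
    fun g hg hgs => ?_
  have hsupp : HasCompactSupport fun x => (g x : ℂ) :=
    hgs.comp_left (g := ((↑) : ℝ → ℂ)) ofReal_zero
  let ψ : 𝓢(V, ℂ) := hsupp.toSchwartzMap (ofRealCLM.contDiff.comp hg)
  let φ : 𝓢(V, ℂ) := 𝓕⁻ ψ
  have hFφ : 𝓕 (φ : V → ℂ) = ψ := by
    rw [← SchwartzMap.fourier_coe]
    exact congrArg _ (FourierTransform.fourier_fourierInv_eq ψ)
  have hφ (x : V) : φ (-x) = 𝓕 (ψ : V → ℂ) x := by
    rw [SchwartzMap.fourierInv_coe, Real.fourierInv_eq_fourier_neg, neg_neg]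
  calc ∫ x, g x • h x = ∫ x, h x * 𝓕 (φ : V → ℂ) x := by
        rw [hFφ]; exact integral_congr_ae (.of_forall fun x => mul_comm (g x : ℂ) (h x))
    _ = ∫ x, 𝓕 h x * φ x := (integral_fourier_mul_eq hh φ.integrable).symm
    _ = ∫ x, 𝓕 h (-x) * 𝓕 (ψ : V → ℂ) x := by
        rw [← integral_neg_eq_self]; simp only [hφ]
    _ = ∫ x, 𝓕 (fun x => 𝓕 h (-x)) x * ψ x :=
        (integral_fourier_mul_eq hFh.comp_neg ψ.integrable).symm
    _ = ∫ x, g x • 𝓕⁻ (𝓕 h) x := by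
        rw [Real.fourierInv_eq_fourier_comp_neg]
        exact integral_congr_ae (.of_forall fun x => mul_comm _ _)

theorem ae_eq_zero_of_fourier_eq_zero {h : V → ℂ} (hh : Integrable h) (hF : ∀ ξ, 𝓕 h ξ = 0) :
    h =ᵐ[volume] 0 := by
  have hinv := ae_eq_fourierInv_fourier hh
    ((integrable_zero V ℂ volume).congr (.of_forall fun ξ => (hF ξ).symm))
  exact hinv.mono fun v hv => by simp [hv, Real.fourierInv_eq, hF]

theorem ae_eq_of_fourier_eq {h k : V → ℂ} (hh : Integrable h) (hk : Integrable k)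
    (hF : ∀ ξ, 𝓕 h ξ = 𝓕 k ξ) : h =ᵐ[volume] k := by
  refine (ae_eq_zero_of_fourier_eq_zero (hh.sub hk) fun ξ => ?_).mono fun v hv => sub_eq_zero.1 hv
  have hξ := hF ξ
  simp only [Real.fourier_eq] at hξ
  simp only [Real.fourier_eq, Pi.sub_apply, smul_sub, hξ, sub_self,
    integral_sub ((Real.fourierIntegral_convergent_iff ξ).2 hh)
      ((Real.fourierIntegral_convergent_iff ξ).2 hk)]

end Fourier

section Hardy

theorem differentiable_integral_mul_cexp {α : Type*} [MeasurableSpace α] {μ : Measure α}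
    {k : α → ℂ} {X : α → ℝ} (hk : AEStronglyMeasurable k μ) (hX : AEMeasurable X μ)
    (hint : ∀ r : ℝ, Integrable (fun t => ‖k t‖ * Real.exp (r * |X t|)) μ) :
    Differentiable ℂ fun ζ : ℂ => ∫ t, k t * cexp (ζ * X t) ∂μ := by
  intro ζ₀
  have hnorm (ζ : ℂ) (t : α) : ‖k t * cexp (ζ * X t)‖ ≤ ‖k t‖ * Real.exp (‖ζ‖ * |X t|) := by
    rw [norm_mul, norm_exp, re_mul_ofReal]
    refine mul_le_mul_of_nonneg_left (Real.exp_le_exp.2 ?_) (norm_nonneg _)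
    calc ζ.re * X t ≤ |ζ.re| * |X t| := (le_abs_self _).trans (abs_mul _ _).le
      _ ≤ ‖ζ‖ * |X t| := by gcongr; exact abs_re_le_norm ζ
  have hX' : AEStronglyMeasurable (fun t => (X t : ℂ)) μ := by fun_prop
  have hmeas (ζ : ℂ) : AEStronglyMeasurable (fun t => k t * cexp (ζ * X t)) μ := by fun_prop
  refine (hasDerivAt_integral_of_dominated_loc_of_deriv_le
    (F' := fun ζ t => k t * cexp (ζ * X t) * X t)
    (bound := fun t => ‖k t‖ * Real.exp ((‖ζ₀‖ + 1 + 1) * |X t|))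
    (Metric.ball_mem_nhds ζ₀ one_pos) (.of_forall hmeas)
    ((hint ‖ζ₀‖).mono' (hmeas ζ₀) (.of_forall (hnorm ζ₀))) ((hmeas ζ₀).mul hX')
    (.of_forall fun t ζ hζ => ?_) (hint _) (.of_forall fun t ζ _ => ?_)).2.differentiableAt
  · have hζ' : ‖ζ‖ ≤ ‖ζ₀‖ + 1 := by
      linarith [norm_le_norm_add_norm_sub' ζ ζ₀, mem_ball_iff_norm.1 hζ]
    calc ‖k t * cexp (ζ * X t) * X t‖ ≤ ‖k t‖ * Real.exp (‖ζ‖ * |X t|) * Real.exp |X t| := by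
          rw [norm_mul, norm_real, Real.norm_eq_abs]
          gcongr
          · exact hnorm ζ t
          · linarith [Real.add_one_le_exp |X t|]
      _ ≤ ‖k t‖ * Real.exp ((‖ζ₀‖ + 1) * |X t|) * Real.exp |X t| := by gcongr
      _ = ‖k t‖ * Real.exp ((‖ζ₀‖ + 1 + 1) * |X t|) := by
          rw [mul_assoc, ← Real.exp_add]; ring_nf
  · have hderiv := (((hasDerivAt_id ζ).mul_const (X t : ℂ)).cexp).const_mul (k t)
    simpa [mul_assoc] using hderiv

variable {V : Type*} [NormedAddCommGroup V] [InnerProductSpace ℝ V] [FiniteDimensional ℝ V]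
  [MeasurableSpace V] [BorelSpace V]

theorem integrable_exp_neg_mul_sq_norm_add {b : ℝ} (hb : 0 < b) (c : ℝ) (w : V) :
    Integrable fun v : V => Real.exp (-b * ‖v‖ ^ 2 + c * ⟪w, v⟫) := by
  refine (GaussianFourier.integrable_cexp_neg_mul_sq_norm_add (b := b) (by simpa) c w).norm.congr
    (.of_forall fun v => ?_)
  simp [norm_exp, ← ofReal_pow]

theorem integrable_gaussian {a : ℝ} (ha : 0 < a) :
    Integrable fun v : V => Real.exp (-π * a * ‖v‖ ^ 2) := by
  simpa using integrable_exp_neg_mul_sq_norm_add (V := V) (mul_pos Real.pi_pos ha) 0 0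

theorem integrable_of_norm_le_gaussian {a C : ℝ} {h : V → ℂ} (ha : 0 < a)
    (hh : AEStronglyMeasurable h)
    (hle : ∀ᵐ v, ‖h v‖ ≤ C * Real.exp (-π * a * ‖v‖ ^ 2)) : Integrable h :=
  ((integrable_gaussian ha).const_mul C).mono' hh hle

theorem integrable_norm_mul_exp_abs_inner {a C : ℝ} {h : V → ℂ} (ha : 0 < a)
    (hh : AEStronglyMeasurable h) (hle : ∀ᵐ v, ‖h v‖ ≤ C * Real.exp (-π * a * ‖v‖ ^ 2))
    (e : V) (r : ℝ) : Integrable fun v => ‖h v‖ * Real.exp (r * |⟪e, v⟫|) := by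
  have hpa : 0 < π * a := mul_pos Real.pi_pos ha
  have hdom := ((integrable_exp_neg_mul_sq_norm_add hpa r e).add
    (integrable_exp_neg_mul_sq_norm_add hpa (-r) e)).const_mul C
  refine hdom.mono' (by fun_prop) (hle.mono fun v hv => ?_)
  have hC : 0 ≤ C := nonneg_of_mul_nonneg_left ((norm_nonneg _).trans hv) (Real.exp_pos _)
  rw [norm_mul, norm_norm, Real.norm_of_nonneg (Real.exp_nonneg _)]
  calc ‖h v‖ * Real.exp (r * |⟪e, v⟫|)
      ≤ C * Real.exp (-π * a * ‖v‖ ^ 2) * (Real.exp (r * ⟪e, v⟫) + Real.exp (-r * ⟪e, v⟫)) := by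
        gcongr
        rcases abs_choice ⟪e, v⟫ with h | h <;> rw [h] <;> simp [Real.exp_nonneg]
    _ = C * (Real.exp (-(π * a) * ‖v‖ ^ 2 + r * ⟪e, v⟫)
          + Real.exp (-(π * a) * ‖v‖ ^ 2 + -r * ⟪e, v⟫)) := by
        simp only [Real.exp_add, neg_mul]; ring

theorem norm_integral_mul_cexp_le {a C : ℝ} {h : V → ℂ} (ha : 0 < a)
    (hle : ∀ᵐ v, ‖h v‖ ≤ C * Real.exp (-π * a * ‖v‖ ^ 2)) {e : V} (he : ‖e‖ = 1) (ζ : ℂ) :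
    ‖∫ v, h v * cexp (-2 * π * I * ζ * ⟪e, v⟫)‖
      ≤ (C * ∫ v : V, Real.exp (-π * a * ‖v‖ ^ 2)) * Real.exp (π / a * ζ.im ^ 2) := by
  have hint := integrable_gaussian (V := V) ha
  calc ‖∫ v, h v * cexp (-2 * π * I * ζ * ⟪e, v⟫)‖
      ≤ ∫ v, C * Real.exp (-π * a * ‖v - (ζ.im / a) • e‖ ^ 2) * Real.exp (π / a * ζ.im ^ 2) := by
        refine norm_integral_le_of_norm_le
          (((hint.comp_sub_right _).const_mul C).mul_const _) (hle.mono fun v hv => ?_)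
        have hexp : ‖cexp (-2 * π * I * ζ * ⟪e, v⟫)‖ = Real.exp (2 * π * ζ.im * ⟪e, v⟫) := by
          rw [norm_exp]; simp
        have hsq : -π * a * ‖v‖ ^ 2 + 2 * π * ζ.im * ⟪e, v⟫
            = -π * a * ‖v - (ζ.im / a) • e‖ ^ 2 + π / a * ζ.im ^ 2 := by
          rw [norm_sub_sq_real, inner_smul_right, norm_smul, he, real_inner_comm e,
            Real.norm_eq_abs, mul_one, sq_abs]
          field_simp
          ring
        rw [norm_mul, hexp, mul_assoc C, ← Real.exp_add, ← hsq, Real.exp_add, ← mul_assoc]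
        gcongr
    _ = (C * ∫ v : V, Real.exp (-π * a * ‖v‖ ^ 2)) * Real.exp (π / a * ζ.im ^ 2) := by
        rw [integral_mul_const, integral_const_mul,
          integral_sub_right_eq_self fun v : V => Real.exp (-π * a * ‖v‖ ^ 2)]

theorem fourier_add_smul_of_gaussian_bounds {a C D : ℝ} {h : V → ℂ} (ha : 0 < a)
    (hh : AEStronglyMeasurable h) (hle : ∀ᵐ v, ‖h v‖ ≤ C * Real.exp (-π * a * ‖v‖ ^ 2))
    {e : V} (he : ‖e‖ = 1) {η : V}
    (hF : ∀ x : ℝ, ‖𝓕 h (η + x • e)‖ ≤ D * Real.exp (-π / a * x ^ 2)) (x : ℝ) :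
    𝓕 h (η + x • e) = 𝓕 h η * Real.exp (-π / a * x ^ 2) := by
  set k : V → ℂ := fun v => Real.fourierChar (-⟪v, η⟫) • h v
  have hk : AEStronglyMeasurable k := by
    refine AEStronglyMeasurable.smul (Continuous.aestronglyMeasurable ?_) hh
    fun_prop
  have hkle : ∀ᵐ v, ‖k v‖ ≤ C * Real.exp (-π * a * ‖v‖ ^ 2) := by simpa [k] using hle
  set Φ : ℂ → ℂ := fun ζ => ∫ v, k v * cexp (-2 * π * I * ζ * ⟪e, v⟫)
  have hΦ : Differentiable ℂ Φ :=
    (differentiable_integral_mul_cexp hk (by fun_prop)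
      (integrable_norm_mul_exp_abs_inner ha hk hkle e)).comp
      (differentiable_id.const_mul (-2 * π * I))
  have hΦF (x : ℝ) : Φ x = 𝓕 h (η + x • e) := by
    rw [Real.fourier_eq']
    refine integral_congr_ae (.of_forall fun v => ?_)
    simp only [k, Circle.smul_def, Real.fourierChar_apply, smul_eq_mul]
    rw [mul_right_comm, ← Complex.exp_add, inner_add_right, inner_smul_right, real_inner_comm e]
    push_cast
    ring_nf
  have hΦle (ζ : ℂ) := norm_integral_mul_cexp_le ha hkle he ζ
  set M := max (C * ∫ v : V, Real.exp (-π * a * ‖v‖ ^ 2)) D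
  have hgauss := eq_gaussian_of_entire_bounds hΦ (div_pos Real.pi_pos ha) (C := M)
    (fun ζ => (hΦle ζ).trans (by gcongr; exact le_max_left _ _))
    (fun x => by
      rw [hΦF, ← neg_div]
      exact (hF x).trans (by gcongr; exact le_max_right _ _)) x
  have hΦ0 : Φ 0 = 𝓕 h η := by simpa using hΦF 0
  rw [← hΦF, hgauss, hΦ0]
  push_cast
  ring_nf

theorem ae_eq_zero_of_gaussian_bounds {a b C D : ℝ} {h : V → ℂ} (ha : 0 < a) (hab : 1 < a * b)
    (hh : AEStronglyMeasurable h) (hle : ∀ᵐ v, ‖h v‖ ≤ C * Real.exp (-π * a * ‖v‖ ^ 2))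
    {e : V} (he : ‖e‖ = 1) (hF : ∀ ξ, ‖𝓕 h ξ‖ ≤ D * Real.exp (-π * b * ⟪e, ξ⟫ ^ 2)) :
    h =ᵐ[volume] 0 := by
  have hba : 0 < b - 1 / a := sub_pos.2 ((div_lt_iff₀ ha).2 (by linarith))
  have hD : 0 ≤ D := by simpa using (norm_nonneg _).trans (hF 0)
  suffices hF0 : ∀ η, ⟪e, η⟫ = 0 → ∀ x : ℝ, 𝓕 h (η + x • e) = 0 by
    refine ae_eq_zero_of_fourier_eq_zero (integrable_of_norm_le_gaussian ha hh hle) fun ξ => ?_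
    have horth : ⟪e, ξ - ⟪e, ξ⟫ • e⟫ = 0 := by
      rw [inner_sub_right, inner_smul_right, real_inner_self_eq_norm_sq, he]; ring
    simpa using hF0 _ horth ⟪e, ξ⟫
  intro η hη
  have hFη (x : ℝ) : ‖𝓕 h (η + x • e)‖ ≤ D * Real.exp (-π * b * x ^ 2) := by
    have hx : ⟪e, η + x • e⟫ = x := by
      rw [inner_add_right, hη, inner_smul_right, real_inner_self_eq_norm_sq, he]; ring
    simpa only [hx] using hF (η + x • e)
  have hline := fourier_add_smul_of_gaussian_bounds ha hh hle he (η := η) (D := D) fun x =>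
    (hFη x).trans (by
      gcongr
      rw [neg_mul, neg_div, div_eq_mul_one_div, neg_le_neg_iff]
      gcongr
      linarith)
  have hFη0 : 𝓕 h η = 0 := by
    have hlim : Tendsto (fun x : ℝ => D * Real.exp (-(π * (b - 1 / a)) * x ^ 2)) atTop (𝓝 0) := by
      have hrate := neg_lt_zero.2 (mul_pos Real.pi_pos hba)
      simpa using (Real.tendsto_exp_atBot.comp
        ((tendsto_pow_atTop two_ne_zero).const_mul_atTop_of_neg hrate)).const_mul D
    refine norm_le_zero_iff.1 (ge_of_tendsto' hlim fun x => ?_)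
    have hx := hFη x
    rw [hline, norm_mul, norm_real, Real.norm_of_nonneg (Real.exp_nonneg _)] at hx
    refine le_of_mul_le_mul_right (hx.trans_eq ?_) (Real.exp_pos (-π / a * x ^ 2))
    rw [mul_assoc D, ← Real.exp_add]
    ring_nf
  exact fun x => by rw [hline, hFη0, zero_mul]

theorem fourier_eq_gaussian_of_gaussian_bounds {a C D : ℝ} {h : V → ℂ} (ha : 0 < a)
    (hh : AEStronglyMeasurable h) (hle : ∀ᵐ v, ‖h v‖ ≤ C * Real.exp (-π * a * ‖v‖ ^ 2))
    (hF : ∀ ξ, ‖𝓕 h ξ‖ ≤ D * Real.exp (-π / a * ‖ξ‖ ^ 2)) (ξ : V) :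
    𝓕 h ξ = 𝓕 h 0 * Real.exp (-π / a * ‖ξ‖ ^ 2) := by
  rcases eq_or_ne ξ 0 with rfl | hξ
  · simp
  have hunit : ‖‖ξ‖⁻¹ • ξ‖ = 1 := norm_smul_inv_norm (𝕜 := ℝ) hξ
  have hline (x : ℝ) := fourier_add_smul_of_gaussian_bounds ha hh hle hunit (η := 0) (D := D)
    (fun x => by simpa [norm_smul, hξ] using hF (0 + x • ‖ξ‖⁻¹ • ξ)) x
  simpa [smul_smul, hξ] using hline ‖ξ‖

theorem fourier_gaussian {a : ℝ} (ha : 0 < a) (ξ : V) :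
    𝓕 (fun v : V => (Real.exp (-π * a * ‖v‖ ^ 2) : ℂ)) ξ
      = (∫ v : V, Real.exp (-π * a * ‖v‖ ^ 2) : ℝ) * Real.exp (-π / a * ‖ξ‖ ^ 2) := by
  have hform (w : V) := fourier_gaussian_innerProductSpace (V := V) (b := ((π * a : ℝ) : ℂ))
    (by rw [ofReal_re]; exact mul_pos Real.pi_pos ha) w
  have hcast : (fun v : V => cexp (-((π * a : ℝ) : ℂ) * ‖v‖ ^ 2))
      = fun v : V => (Real.exp (-π * a * ‖v‖ ^ 2) : ℂ) := by
    ext v; push_cast; ring_nf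
  rw [hcast] at hform
  have hform0 := hform 0
  rw [Real.fourier_eq] at hform0
  simp only [inner_zero_right, neg_zero, AddChar.map_zero_eq_one, one_smul,
    norm_zero] at hform0
  rw [hform, ← integral_complex_ofReal, hform0]
  push_cast
  field_simp
  simp

theorem ae_eq_gaussian_of_gaussian_bounds {a C D : ℝ} {h : V → ℂ} (ha : 0 < a)
    (hh : AEStronglyMeasurable h) (hle : ∀ᵐ v, ‖h v‖ ≤ C * Real.exp (-π * a * ‖v‖ ^ 2))
    (hF : ∀ ξ, ‖𝓕 h ξ‖ ≤ D * Real.exp (-π / a * ‖ξ‖ ^ 2)) :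
    h =ᵐ[volume] fun v => (∫ w, h w) / (∫ w : V, Real.exp (-π * a * ‖w‖ ^ 2) : ℝ)
      * Real.exp (-π * a * ‖v‖ ^ 2) := by
  have hgauss := integrable_gaussian (V := V) ha
  refine ae_eq_of_fourier_eq (integrable_of_norm_le_gaussian ha hh hle)
    (hgauss.ofReal.const_mul _) fun ξ => ?_
  have hpos : ((∫ v : V, Real.exp (-π * a * ‖v‖ ^ 2) : ℝ) : ℂ) ≠ 0 :=
    ofReal_ne_zero.2 (integral_exp_pos hgauss).ne'
  have hF0 : 𝓕 h 0 = ∫ w, h w := by simp [Real.fourier_eq]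
  rw [fourier_eq_gaussian_of_gaussian_bounds ha hh hle hF, fourier_const_mul,
    fourier_gaussian ha, hF0, ← mul_assoc, div_mul_cancel₀ _ hpos]

end Hardy

section Wigner

variable {V : Type*} [NormedAddCommGroup V] [InnerProductSpace ℝ V] [FiniteDimensional ℝ V]
  [MeasurableSpace V] [BorelSpace V]

/-- The map `(m, t) ↦ (m + t/2, m - t/2)` from the midpoint and the difference of two points to the
points themselves; its inverse passes to the variables of the Wigner distribution. -/
noncomputable def midpointDiffEquiv (V : Type*) [NormedAddCommGroup V] [InnerProductSpace ℝ V]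
    [FiniteDimensional ℝ V] [MeasurableSpace V] [BorelSpace V] : V × V ≃ᵐ V × V where
  toFun p := (p.1 + (1 / 2 : ℝ) • p.2, p.1 - (1 / 2 : ℝ) • p.2)
  invFun q := ((1 / 2 : ℝ) • (q.1 + q.2), q.1 - q.2)
  left_inv p := by ext <;> module
  right_inv q := by ext <;> module
  measurable_toFun := by dsimp only [Equiv.coe_fn_mk]; fun_prop
  measurable_invFun := by dsimp only [Equiv.symm, Equiv.coe_fn_mk]; fun_prop

theorem measurePreserving_midpointDiffEquiv : MeasurePreserving (midpointDiffEquiv V) := by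
  have hmidpoint : MeasurePreserving fun p : V × V => (p.1, p.2 + (1 / 2 : ℝ) • p.1) :=
    (MeasurePreserving.id volume).skew_product (by fun_prop)
      (.of_forall fun t => map_add_right_eq_self volume ((1 / 2 : ℝ) • t))
  have hdiff : MeasurePreserving fun p : V × V => (p.1, p.1 - p.2) :=
    (MeasurePreserving.id volume).skew_product (by fun_prop)
      (.of_forall fun u => Measure.map_sub_left_eq_self volume u)
  convert hdiff.comp (Measure.measurePreserving_swap.comp (hmidpoint.comp
    Measure.measurePreserving_swap)) using 1
  · ext p
    · rfl
    · simp only [midpointDiffEquiv, MeasurableEquiv.coe_mk, Equiv.coe_fn_mk, Function.comp_apply,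
        Prod.fst_swap, Prod.snd_swap]
      module
  · rfl

theorem ae_prod_of_ae_midpoint_ae_diff {P : V × V → Prop} (hP : MeasurableSet {q | P q})
    (h : ∀ᵐ m, ∀ᵐ t, P (m + (1 / 2 : ℝ) • t, m - (1 / 2 : ℝ) • t)) : ∀ᵐ q, P q := by
  have hprod : ∀ᵐ p, P (midpointDiffEquiv V p) :=
    (Measure.ae_prod_iff_ae_ae ((midpointDiffEquiv V).measurable hP)).2 h
  refine ((measurePreserving_midpointDiffEquiv (V := V)).symm.quasiMeasurePreserving.ae
    hprod).mono fun q hq => ?_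
  rwa [MeasurableEquiv.apply_symm_apply] at hq

/-- The cross-Wigner distribution on a Euclidean space `V`, written as the Fourier transform of
`t ↦ f (x + t/2) conj (g (x - t/2))`. -/
noncomputable def wigner (f g : V → ℂ) (x ξ : V) : ℂ :=
  𝓕 (fun t => f (x + (1 / 2 : ℝ) • t) * conj (g (x - (1 / 2 : ℝ) • t))) ξ

theorem crossWigner_eq_wigner {d : ℕ} (f g : EuclideanSpace ℝ (Fin d) → ℂ)
    (x ξ : EuclideanSpace ℝ (Fin d)) : crossWigner f g x ξ = wigner f g x ξ := by
  rw [wigner, Real.fourier_eq']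
  refine integral_congr_ae (.of_forall fun t => ?_)
  simp only [smul_eq_mul]
  rw [mul_comm (cexp _), real_inner_comm]
  push_cast
  ring_nf

theorem memLp_two_comp_add_smul {f : V → ℂ} (hf : MemLp f 2) (x : V) {r : ℝ} (hr : r ≠ 0) :
    MemLp (fun t => f (x + r • t)) 2 := by
  have hx : MemLp (fun t => f (x + t)) 2 :=
    hf.comp_measurePreserving (measurePreserving_add_left volume x)
  refine MemLp.comp_of_map (g := fun t => f (x + t)) (f := fun t => r • t) ?_ (by fun_prop)
  rw [Measure.map_addHaar_smul volume hr]
  exact hx.smul_measure ENNReal.ofReal_ne_top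

theorem integrable_mul_conj_of_memLp_two {f g : V → ℂ} (hf : MemLp f 2) (hg : MemLp g 2) (x : V) :
    Integrable fun t => f (x + (1 / 2 : ℝ) • t) * conj (g (x - (1 / 2 : ℝ) • t)) := by
  have hg' := (memLp_two_comp_add_smul hg x (r := -(1 / 2)) (by norm_num)).star
  refine ((memLp_two_comp_add_smul hf x (r := 1 / 2) (by norm_num)).integrable_mul hg').congr
    (.of_forall fun t => ?_)
  simp [sub_eq_add_neg]

theorem integrable_fourierChar_smul_mul_conj {h k : V → ℂ} (hh : Integrable h) (hk : Integrable k)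
    (u v : V) : Integrable fun q : V × V =>
      (𝐞 (-⟪q.1, u⟫) • h q.1) * conj (𝐞 (-⟪q.2, v⟫) • k q.2) :=
  ((Real.fourierIntegral_convergent_iff u).2 hh).mul_prod
    (conjCLE.toContinuousLinearMap.integrable_comp ((Real.fourierIntegral_convergent_iff v).2 hk))

theorem fourierChar_smul_mul_conj_midpointDiffEquiv (h k : V → ℂ) (w t : V) (p : V × V) :
    (𝐞 (-⟪(midpointDiffEquiv V p).1, w + (1 / 2 : ℝ) • t⟫) • h (midpointDiffEquiv V p).1) *
      conj (𝐞 (-⟪(midpointDiffEquiv V p).2, w - (1 / 2 : ℝ) • t⟫) • k (midpointDiffEquiv V p).2)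
    = 𝐞 (-⟪p.1, t⟫) • 𝐞 (-⟪p.2, w⟫) •
      (h (p.1 + (1 / 2 : ℝ) • p.2) * conj (k (p.1 - (1 / 2 : ℝ) • p.2))) := by
  have hphase : -⟪p.1 + (1 / 2 : ℝ) • p.2, w + (1 / 2 : ℝ) • t⟫
      + ⟪p.1 - (1 / 2 : ℝ) • p.2, w - (1 / 2 : ℝ) • t⟫ = -⟪p.1, t⟫ + -⟪p.2, w⟫ := by
    simp only [inner_add_left, inner_add_right, inner_sub_left, inner_sub_right, inner_smul_left,
      inner_smul_right, RCLike.conj_to_real]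
    ring
  have hchar := congrArg (fun r => ((𝐞 r : Circle) : ℂ)) hphase
  simp only [AddChar.map_add_eq_mul, Circle.coe_mul] at hchar
  simp only [midpointDiffEquiv, MeasurableEquiv.coe_mk, Equiv.coe_fn_mk, Circle.smul_def,
    smul_eq_mul, map_mul, ← Circle.coe_inv_eq_conj, ← AddChar.map_neg_eq_inv, neg_neg]
  linear_combination (h (p.1 + (1 / 2 : ℝ) • p.2) * conj (k (p.1 - (1 / 2 : ℝ) • p.2))) * hchar

theorem fourier_wigner_left {h k : V → ℂ} (hh : Integrable h) (hk : Integrable k) (w t : V) :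
    𝓕 (fun m => wigner h k m w) t
      = 𝓕 h (w + (1 / 2 : ℝ) • t) * conj (𝓕 k (w - (1 / 2 : ℝ) • t)) := by
  have hint := measurePreserving_midpointDiffEquiv.integrable_comp_of_integrable
    (integrable_fourierChar_smul_mul_conj hh hk (w + (1 / 2 : ℝ) • t) (w - (1 / 2 : ℝ) • t))
  have hcoord := measurePreserving_midpointDiffEquiv.integral_comp' fun q : V × V =>
    (𝐞 (-⟪q.1, w + (1 / 2 : ℝ) • t⟫) • h q.1) * conj (𝐞 (-⟪q.2, w - (1 / 2 : ℝ) • t⟫) • k q.2)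
  simp only [Function.comp_def, fourierChar_smul_mul_conj_midpointDiffEquiv] at hint hcoord
  have hprod := integral_prod_mul (μ := (volume : Measure V)) (ν := (volume : Measure V))
    (fun u => 𝐞 (-⟪u, w + (1 / 2 : ℝ) • t⟫) • h u)
    fun v => conj (𝐞 (-⟪v, w - (1 / 2 : ℝ) • t⟫) • k v)
  rw [Measure.volume_eq_prod, integral_prod _ hint, hprod, integral_conj] at hcoord
  simpa only [Real.fourier_eq, wigner, integral_const_mul, Circle.smul_def, smul_eq_mul]
    using hcoord

theorem integrable_wigner_left {h k : V → ℂ} (hh : Integrable h) (hk : Integrable k) (w : V) :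
    Integrable fun m => wigner h k m w := by
  have hint := measurePreserving_midpointDiffEquiv.integrable_comp_of_integrable
    (integrable_fourierChar_smul_mul_conj hh hk (w + (1 / 2 : ℝ) • 0) (w - (1 / 2 : ℝ) • 0))
  simp only [Function.comp_def, fourierChar_smul_mul_conj_midpointDiffEquiv, inner_zero_right,
    neg_zero, AddChar.map_zero_eq_one, one_smul] at hint
  simpa only [wigner, Real.fourier_eq] using hint.integral_prod_left

theorem mul_conj_ae_eq_fourier_mul_conj {g g' h h' : V → ℂ} {N : ℂ} (hg : StronglyMeasurable g)
    (hg' : StronglyMeasurable g') (hgL : MemLp g 2) (hgL' : MemLp g' 2) (hh : Integrable h)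
    (hh' : Integrable h')
    (hW : ∀ᵐ p : V × V, wigner g g' p.1 p.2 = N * wigner h h' (-p.2) p.1) :
    ∀ᵐ q : V × V, g q.1 * conj (g' q.2) = N * (𝓕 h q.1 * conj (𝓕 h' q.2)) := by
  have hgm := hg.measurable
  have hgm' := hg'.measurable
  have hFm := (continuous_fourier hh).measurable
  have hFm' := (continuous_fourier hh').measurable
  have hconj := continuous_conj.measurable
  refine ae_prod_of_ae_midpoint_ae_diff (measurableSet_eq_fun (by fun_prop) (by fun_prop)) ?_
  filter_upwards [Measure.ae_ae_of_ae_prod hW] with w hw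
  have hint := ((integrable_wigner_left hh hh' w).const_mul N).comp_neg
  filter_upwards [ae_eq_fourierInv_fourier (integrable_mul_conj_of_memLp_two hgL hgL' w)
    (hint.congr (hw.mono fun ξ hξ => hξ.symm))] with t ht
  rw [ht, ← fourier_wigner_left hh hh', Real.fourierInv_eq_fourier_comp_neg]
  have hw' := (Measure.measurePreserving_neg (volume : Measure V)).quasiMeasurePreserving.ae hw
  simp only [neg_neg] at hw'
  rw [← fourier_const_mul, Real.fourier_eq, Real.fourier_eq]
  refine integral_congr_ae (hw'.mono fun m hm => ?_)
  exact congrArg (𝐞 (-⟪m, t⟫) • ·) hm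

end Wigner

section Slices

/-- The restriction of a function on the Euclidean product of `V` and `W` to the fibre `V × {y}`. -/
def slice {V W : Type*} (G : WithLp 2 (V × W) → ℂ) (y : W) (x : V) : ℂ := G (WithLp.toLp 2 (x, y))

theorem stronglyMeasurable_slice {V W : Type*} [MeasurableSpace V] [MeasurableSpace W]
    {G : WithLp 2 (V × W) → ℂ} (hG : StronglyMeasurable G) (y : W) :
    StronglyMeasurable (slice G y) :=
  hG.comp_measurable (by fun_prop)

variable {V W : Type*} [NormedAddCommGroup V] [InnerProductSpace ℝ V] [FiniteDimensional ℝ V]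
  [MeasurableSpace V] [BorelSpace V] [MeasurableSpace W]

theorem stronglyMeasurable_wigner_slice {Z : Type*} [MeasurableSpace Z] {G : WithLp 2 (V × W) → ℂ}
    (hG : StronglyMeasurable G) {y y' : Z → W} {x ξ : Z → V} (hy : Measurable y)
    (hy' : Measurable y') (hx : Measurable x) (hξ : Measurable ξ) :
    StronglyMeasurable fun z => wigner (slice G (y z)) (slice G (y' z)) (x z) (ξ z) := by
  simp only [wigner, Real.fourier_eq', slice]
  have hGm := hG.measurable
  have hconj := continuous_conj.measurable
  refine StronglyMeasurable.integral_prod_right (Measurable.stronglyMeasurable ?_)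
  simp only [Function.uncurry_def]
  fun_prop

theorem stronglyMeasurable_integral_slice {H : WithLp 2 (V × W) → ℂ} (hHm : StronglyMeasurable H) :
    StronglyMeasurable fun y => ∫ x, slice H y x :=
  StronglyMeasurable.integral_prod_right (hHm.comp_measurable (by fun_prop))

variable [NormedAddCommGroup W] [InnerProductSpace ℝ W] [FiniteDimensional ℝ W] [BorelSpace W]

theorem ae_ae_slice {P : WithLp 2 (V × W) → Prop} (h : ∀ᵐ z, P z) :
    ∀ᵐ y : W, ∀ᵐ x : V, P (WithLp.toLp 2 (x, y)) :=
  Measure.ae_ae_of_ae_prod (((WithLp.volume_preserving_toLp V W).comp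
    Measure.measurePreserving_swap).quasiMeasurePreserving.ae h)

theorem ae_of_ae_ae_slice {P : WithLp 2 (V × W) → Prop} (hP : MeasurableSet {z | P z})
    (h : ∀ᵐ y : W, ∀ᵐ x : V, P (WithLp.toLp 2 (x, y))) : ∀ᵐ z, P z := by
  have hprod : ∀ᵐ p : W × V, P (WithLp.toLp 2 p.swap) :=
    (Measure.ae_prod_iff_ae_ae (measurableSet_preimage (by fun_prop) hP)).2 h
  have hofLp := WithLp.volume_preserving_ofLp V W
  exact (Measure.measurePreserving_swap.comp hofLp).quasiMeasurePreserving.ae hprod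

theorem integrable_toLp_prod {E : Type*} [NormedAddCommGroup E] {k : WithLp 2 (V × W) → E}
    (hk : Integrable k) :
    Integrable (fun p : V × W => k (WithLp.toLp 2 p)) (volume.prod volume) :=
  (WithLp.volume_preserving_toLp V W).integrable_comp_of_integrable hk

theorem integrable_fourier_slice {k : WithLp 2 (V × W) → ℂ} (hk : Integrable k) (ξ : V) :
    Integrable fun τ => 𝓕 (slice k τ) ξ := by
  have hint := integrable_toLp_prod ((Real.fourierIntegral_convergent_iff
    (WithLp.toLp 2 (ξ, (0 : W)))).2 hk)
  simpa [Real.fourier_eq, slice] using hint.integral_prod_right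

theorem fourier_fourier_slice {k : WithLp 2 (V × W) → ℂ} (hk : Integrable k) (ξ : V) (η : W) :
    𝓕 (fun τ => 𝓕 (slice k τ) ξ) η = 𝓕 k (WithLp.toLp 2 (ξ, η)) := by
  have hint := integrable_toLp_prod ((Real.fourierIntegral_convergent_iff
    (WithLp.toLp 2 (ξ, η))).2 hk)
  rw [Real.fourier_eq, Real.fourier_eq, ← (WithLp.volume_preserving_toLp V W).integral_comp
    (MeasurableEquiv.toLp 2 (V × W)).measurableEmbedding, Measure.volume_eq_prod,
    integral_prod_symm _ hint]
  refine integral_congr_ae (.of_forall fun τ => ?_)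
  simp only [Real.fourier_eq, Circle.smul_def, smul_eq_mul, ← integral_const_mul, slice,
    WithLp.prod_inner_apply, neg_add, AddChar.map_add_eq_mul, Circle.coe_mul]
  refine integral_congr_ae (.of_forall fun x => ?_)
  ring

theorem wigner_slice_ae_eq {G H : WithLp 2 (V × W) → ℂ} {N : ℂ} (hG : MemLp G 2) (hH : MemLp H 2)
    {x ξ x' ξ' : V} {y : W}
    (hW : ∀ η, wigner G G (WithLp.toLp 2 (x, y)) (WithLp.toLp 2 (ξ, η))
      = N * wigner H H (WithLp.toLp 2 (x', y)) (WithLp.toLp 2 (ξ', η))) :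
    ∀ᵐ τ : W, wigner (slice G (y + (1 / 2 : ℝ) • τ)) (slice G (y - (1 / 2 : ℝ) • τ)) x ξ
      = N * wigner (slice H (y + (1 / 2 : ℝ) • τ)) (slice H (y - (1 / 2 : ℝ) • τ)) x' ξ' := by
  have hGi := integrable_mul_conj_of_memLp_two hG hG (WithLp.toLp 2 (x, y))
  have hHi := integrable_mul_conj_of_memLp_two hH hH (WithLp.toLp 2 (x', y))
  refine ae_eq_of_fourier_eq (integrable_fourier_slice hGi ξ)
    ((integrable_fourier_slice hHi ξ').const_mul N) fun η => ?_
  rw [fourier_const_mul]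
  exact (fourier_fourier_slice hGi ξ η).trans ((hW η).trans
    (congrArg (N * ·) (fourier_fourier_slice hHi ξ' η).symm))

/-- On the Wigner distributions, `G` is a multiple of the partial Fourier transform of `H` in the
first variable: up to the factor `N`, the distribution of `G` is that of `H` precomposed with a
quarter turn in the phase space of that variable. -/
def IsPartialFourier (N : ℂ) (H G : WithLp 2 (V × W) → ℂ) : Prop :=
  ∀ x ξ y η, wigner G G (WithLp.toLp 2 (x, y)) (WithLp.toLp 2 (ξ, η))
    = N * wigner H H (WithLp.toLp 2 (-ξ, y)) (WithLp.toLp 2 (x, η))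

theorem ae_ae_wigner_slice_eq {G H : WithLp 2 (V × W) → ℂ} {N : ℂ} (hGm : StronglyMeasurable G)
    (hHm : StronglyMeasurable H) (hG : MemLp G 2) (hH : MemLp H 2)
    (hGH : IsPartialFourier N H G) :
    ∀ᵐ q : W × W, ∀ᵐ p : V × V, wigner (slice G q.1) (slice G q.2) p.1 p.2
      = N * wigner (slice H q.1) (slice H q.2) (-p.2) p.1 := by
  have hleft : StronglyMeasurable fun z : (V × V) × W × W =>
      wigner (slice G z.2.1) (slice G z.2.2) z.1.1 z.1.2 :=
    stronglyMeasurable_wigner_slice hGm (by fun_prop) (by fun_prop) (by fun_prop) (by fun_prop)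
  have hright : StronglyMeasurable fun z : (V × V) × W × W =>
      wigner (slice H z.2.1) (slice H z.2.2) (-z.1.2) z.1.1 :=
    stronglyMeasurable_wigner_slice hHm (by fun_prop) (by fun_prop) (by fun_prop) (by fun_prop)
  have hmeas := measurableSet_eq_fun hleft.measurable (hright.measurable.const_mul N)
  refine (Measure.ae_ae_comm (p := fun (p : V × V) (q : W × W) =>
    wigner (slice G q.1) (slice G q.2) p.1 p.2
      = N * wigner (slice H q.1) (slice H q.2) (-p.2) p.1) hmeas).1 (.of_forall fun p => ?_)
  refine ae_prod_of_ae_midpoint_ae_diff (measurable_prodMk_left hmeas)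
    (.of_forall fun y => ?_)
  exact wigner_slice_ae_eq hG hH fun η => hGH p.1 p.2 y η

theorem memLp_two_slice {G : WithLp 2 (V × W) → ℂ} (hGm : StronglyMeasurable G)
    (hG : MemLp G 2) : ∀ᵐ y, MemLp (slice G y) 2 := by
  have hsq := integrable_toLp_prod
    ((memLp_two_iff_integrable_sq_norm hGm.aestronglyMeasurable).1 hG)
  filter_upwards [hsq.prod_left_ae] with y hy
  have hGy := (stronglyMeasurable_slice hGm y).aestronglyMeasurable (μ := volume)
  exact (memLp_two_iff_integrable_sq_norm hGy).2 hy

theorem ae_eq_zero_of_slice {H : WithLp 2 (V × W) → ℂ} (hHm : StronglyMeasurable H)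
    (h : ∀ᵐ y, slice H y =ᵐ[volume] 0) : H =ᵐ[volume] 0 :=
  ae_of_ae_ae_slice (P := fun z => H z = 0)
    (hHm.measurableSet_eq_fun stronglyMeasurable_const) h

theorem ae_fourier_slice_eq_const_mul {G H : WithLp 2 (V × W) → ℂ} {N : ℂ} (hN : N ≠ 0)
    (hGm : StronglyMeasurable G) (hHm : StronglyMeasurable H) (hG : MemLp G 2) (hH : MemLp H 2)
    (hHi : ∀ᵐ y, Integrable (slice H y)) (hH0 : ¬ H =ᵐ[volume] 0)
    (hGH : IsPartialFourier N H G) :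
    ∀ᵐ y, ∃ K : ℂ, ∀ᵐ ξ, 𝓕 (slice H y) ξ = K * slice G y ξ := by
  have hwigner := Measure.ae_ae_of_ae_prod ((Measure.measurePreserving_swap (μ := volume)
    (ν := volume)).quasiMeasurePreserving.ae (ae_ae_wigner_slice_eq hGm hHm hG hH hGH))
  have hG2 := memLp_two_slice hGm hG
  obtain ⟨y', hy'0, hy'W, hy'H, hy'G⟩ := ((show ∃ᶠ y' in ae volume, ¬ slice H y' =ᵐ[volume] 0 from
    fun h => hH0 (ae_eq_zero_of_slice hHm (by simpa using h))).and_eventually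
      (hwigner.and (hHi.and hG2))).exists
  have hF0 : ∃ᶠ v in ae volume, 𝓕 (slice H y') v ≠ 0 := fun h => hy'0 <|
    ae_eq_zero_of_fourier_eq_zero hy'H fun v => congrFun ((continuous_fourier hy'H).ae_eq_iff_eq
      volume continuous_const |>.1 (h.mono fun v hv => not_not.1 hv)) v
  filter_upwards [hy'W, hHi, hG2] with y hyW hyH hyG
  have htensor := mul_conj_ae_eq_fourier_mul_conj (stronglyMeasurable_slice hGm y)
    (stronglyMeasurable_slice hGm y') hyG hy'G hyH hy'H hyW
  obtain ⟨v, hv0, hv⟩ := (hF0.and_eventually (Measure.ae_ae_of_ae_prod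
    ((Measure.measurePreserving_swap (μ := volume) (ν := volume)).quasiMeasurePreserving.ae
      htensor))).exists
  refine ⟨conj (slice G y' v) / (N * conj (𝓕 (slice H y') v)), hv.mono fun ξ hξ => ?_⟩
  have hconj : conj (𝓕 (slice H y') v) ≠ 0 := (map_ne_zero _).2 hv0
  rw [div_mul_eq_mul_div, eq_div_iff (mul_ne_zero hN hconj)]
  simp only [Prod.fst_swap, Prod.snd_swap] at hξ
  linear_combination -hξ

theorem forall_of_ae_of_isClosed {p : V → Prop} (hp : IsClosed {x | p x}) (h : ∀ᵐ x, p x) (x : V) :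
    p x :=
  hp.closure_subset_iff.2 subset_rfl ((Measure.dense_of_ae h) x)

theorem ae_exists_norm_fourier_slice_le {G H : WithLp 2 (V × W) → ℂ} {N : ℂ} (hN : N ≠ 0)
    (hGm : StronglyMeasurable G) (hHm : StronglyMeasurable H) (hG : MemLp G 2) (hH : MemLp H 2)
    (hHi : ∀ᵐ y, Integrable (slice H y)) (hH0 : ¬ H =ᵐ[volume] 0)
    (hGH : IsPartialFourier N H G) {β : W → ℝ} {ρ : V → ℝ} (hρ : Continuous ρ)
    (hle : ∀ᵐ z, ‖G z‖ ≤ β z.snd * ρ z.fst) :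
    ∀ᵐ y, ∃ D, ∀ ξ, ‖𝓕 (slice H y) ξ‖ ≤ D * ρ ξ := by
  filter_upwards [ae_fourier_slice_eq_const_mul hN hGm hHm hG hH hHi hH0 hGH, hHi,
    ae_ae_slice hle] with y ⟨K, hK⟩ hyH hyG
  refine ⟨‖K‖ * β y, forall_of_ae_of_isClosed
    (isClosed_le (continuous_fourier hyH).norm (by fun_prop)) ?_⟩
  filter_upwards [hK, hyG] with ξ hξ hξG
  rw [hξ, norm_mul, mul_assoc]
  exact mul_le_mul_of_nonneg_left hξG (norm_nonneg K)

theorem integrable_slice_of_norm_le_gaussian {H : WithLp 2 (V × W) → ℂ} {α : W → ℝ} {a : ℝ}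
    (ha : 0 < a) (hHm : StronglyMeasurable H)
    (hle : ∀ᵐ z, ‖H z‖ ≤ α z.snd * Real.exp (-π * a * ‖z.fst‖ ^ 2)) :
    ∀ᵐ y, Integrable (slice H y) := by
  filter_upwards [ae_ae_slice hle] with y hy
  exact integrable_of_norm_le_gaussian (C := α y) ha
    (stronglyMeasurable_slice hHm y).aestronglyMeasurable hy

theorem ae_eq_zero_of_partialFourier_gaussian_bounds {G H : WithLp 2 (V × W) → ℂ} {N : ℂ}
    (hN : N ≠ 0) (hGm : StronglyMeasurable G) (hHm : StronglyMeasurable H) (hG : MemLp G 2)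
    (hH : MemLp H 2) (hGH : IsPartialFourier N H G) {α β : W → ℝ} {a b : ℝ} (ha : 0 < a)
    (hab : 1 < a * b) {e : V} (he : ‖e‖ = 1)
    (hHle : ∀ᵐ z, ‖H z‖ ≤ α z.snd * Real.exp (-π * a * ‖z.fst‖ ^ 2))
    (hGle : ∀ᵐ z, ‖G z‖ ≤ β z.snd * Real.exp (-π * b * ⟪e, z.fst⟫ ^ 2)) : H =ᵐ[volume] 0 := by
  by_contra hH0
  refine hH0 (ae_eq_zero_of_slice hHm ?_)
  filter_upwards [ae_ae_slice hHle, ae_exists_norm_fourier_slice_le hN hGm hHm hG hH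
    (integrable_slice_of_norm_le_gaussian ha hHm hHle) hH0 hGH
    (ρ := fun ξ => Real.exp (-π * b * ⟪e, ξ⟫ ^ 2)) (by fun_prop) hGle] with y hy ⟨D, hD⟩
  exact ae_eq_zero_of_gaussian_bounds (C := α y) ha hab
    (stronglyMeasurable_slice hHm y).aestronglyMeasurable hy he hD

theorem memLp_two_of_ae_eq_mul {H : WithLp 2 (V × W) → ℂ} (hHm : StronglyMeasurable H)
    (hH : MemLp H 2) {γ : W → ℂ} (hγ : StronglyMeasurable γ) {ρ : V → ℂ} (hρ : ∀ x, ρ x ≠ 0)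
    (hHγ : ∀ᵐ z, H z = γ z.snd * ρ z.fst) : MemLp γ 2 := by
  have hsq := integrable_toLp_prod
    ((memLp_two_iff_integrable_sq_norm hHm.aestronglyMeasurable).1 hH)
  obtain ⟨x, hxsq, hxγ⟩ := (hsq.prod_right_ae.and (Measure.ae_ae_of_ae_prod
    ((WithLp.volume_preserving_toLp V W).quasiMeasurePreserving.ae hHγ))).exists
  refine (memLp_two_iff_integrable_sq_norm hγ.aestronglyMeasurable).2
    ((hxsq.div_const (‖ρ x‖ ^ 2)).congr (hxγ.mono fun y hy => ?_))
  simp only [hy, norm_mul, mul_pow]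
  exact mul_div_cancel_right₀ _ (pow_ne_zero 2 (norm_ne_zero_iff.2 (hρ x)))

theorem exists_memLp_two_ae_eq_mul_gaussian {G H : WithLp 2 (V × W) → ℂ} {N : ℂ} (hN : N ≠ 0)
    (hGm : StronglyMeasurable G) (hHm : StronglyMeasurable H) (hG : MemLp G 2) (hH : MemLp H 2)
    (hH0 : ¬ H =ᵐ[volume] 0) (hGH : IsPartialFourier N H G) {α β : W → ℝ} {a : ℝ} (ha : 0 < a)
    (hHle : ∀ᵐ z, ‖H z‖ ≤ α z.snd * Real.exp (-π * a * ‖z.fst‖ ^ 2))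
    (hGle : ∀ᵐ z, ‖G z‖ ≤ β z.snd * Real.exp (-π / a * ‖z.fst‖ ^ 2)) :
    ∃ γ : W → ℂ, MemLp γ 2 ∧ ∀ᵐ z, H z = γ z.snd * Real.exp (-π * a * ‖z.fst‖ ^ 2) := by
  have hγ := ((stronglyMeasurable_integral_slice hHm).measurable.div_const
    ((∫ w : V, Real.exp (-π * a * ‖w‖ ^ 2) : ℝ) : ℂ)).stronglyMeasurable
  have hHγ : ∀ᵐ z, H z = (∫ x, slice H z.snd x) / ((∫ w : V, Real.exp (-π * a * ‖w‖ ^ 2) : ℝ) : ℂ)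
      * Real.exp (-π * a * ‖z.fst‖ ^ 2) := by
    refine ae_of_ae_ae_slice (hHm.measurableSet_eq_fun ((hγ.comp_measurable (by fun_prop)).mul
      (Measurable.stronglyMeasurable (by fun_prop)))) ?_
    filter_upwards [ae_ae_slice hHle, ae_exists_norm_fourier_slice_le hN hGm hHm hG hH
      (integrable_slice_of_norm_le_gaussian ha hHm hHle) hH0 hGH
      (ρ := fun ξ => Real.exp (-π / a * ‖ξ‖ ^ 2)) (by fun_prop) hGle] with y hy ⟨D, hD⟩
    exact ae_eq_gaussian_of_gaussian_bounds (C := α y) ha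
      (stronglyMeasurable_slice hHm y).aestronglyMeasurable hy hD
  exact ⟨_, memLp_two_of_ae_eq_mul hHm hH hγ
    (ρ := fun x => (Real.exp (-π * a * ‖x‖ ^ 2) : ℂ)) (fun x => by simp) hHγ, hHγ⟩

end Slices

section Covariance

variable {V V' : Type*} [NormedAddCommGroup V] [InnerProductSpace ℝ V]

/-- Multiplication by the chirp `exp (πi ⟪Q v, v⟫)`, the metaplectic operator that shears the
frequency variable. -/
noncomputable def chirp (Q : V →ₗ[ℝ] V) (f : V → ℂ) (v : V) : ℂ := 𝐞 (1 / 2 * ⟪Q v, v⟫) • f v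

theorem norm_chirp (Q : V →ₗ[ℝ] V) (f : V → ℂ) (v : V) : ‖chirp Q f v‖ = ‖f v‖ :=
  Circle.norm_smul _ _

theorem chirp_neg_chirp (Q : V →ₗ[ℝ] V) (f : V → ℂ) : chirp (-Q) (chirp Q f) = f := by
  ext v
  rw [chirp, chirp, smul_smul, ← AddChar.map_add_eq_mul, LinearMap.neg_apply, inner_neg_left,
    mul_neg, neg_add_cancel, AddChar.map_zero_eq_one, one_smul]

variable [FiniteDimensional ℝ V] [MeasurableSpace V] [BorelSpace V] [NormedAddCommGroup V']
  [InnerProductSpace ℝ V'] [FiniteDimensional ℝ V'] [MeasurableSpace V'] [BorelSpace V']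

theorem stronglyMeasurable_chirp (Q : V →ₗ[ℝ] V) {f : V → ℂ} (hf : StronglyMeasurable f) :
    StronglyMeasurable (chirp Q f) := by
  have hQ : Continuous Q := Q.continuous_of_finiteDimensional
  exact (Continuous.stronglyMeasurable (by fun_prop)).smul hf

theorem memLp_chirp (Q : V →ₗ[ℝ] V) {f : V → ℂ} {p : ENNReal} (hf : MemLp f p) :
    MemLp (chirp Q f) p := by
  have hQ : Continuous Q := Q.continuous_of_finiteDimensional
  exact hf.of_le ((Continuous.aestronglyMeasurable (by fun_prop)).smul hf.1)
    (.of_forall fun v => (norm_chirp Q f v).le)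

theorem wigner_chirp {Q : V →ₗ[ℝ] V} (hQ : Q.IsSymmetric) (f g : V → ℂ) (x ξ : V) :
    wigner (chirp Q f) (chirp Q g) x ξ = wigner f g x (ξ - Q x) := by
  simp only [wigner, Real.fourier_eq]
  refine integral_congr_ae (.of_forall fun t => ?_)
  have hphase : -⟪t, ξ⟫ + 1 / 2 * ⟪Q (x + (1 / 2 : ℝ) • t), x + (1 / 2 : ℝ) • t⟫
      + -(1 / 2 * ⟪Q (x - (1 / 2 : ℝ) • t), x - (1 / 2 : ℝ) • t⟫) = -⟪t, ξ - Q x⟫ := by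
    simp only [map_add, map_sub, map_smul, inner_add_left, inner_add_right, inner_sub_left,
      inner_sub_right, inner_smul_left, inner_smul_right, RCLike.conj_to_real, hQ t x,
      real_inner_comm t (Q x)]
    ring
  have hchar := congrArg (fun r => ((𝐞 r : Circle) : ℂ)) hphase
  simp only [AddChar.map_add_eq_mul, Circle.coe_mul] at hchar
  simp only [chirp, Circle.smul_def, smul_eq_mul, map_mul, ← Circle.coe_inv_eq_conj,
    ← AddChar.map_neg_eq_inv]
  linear_combination (f (x + (1 / 2 : ℝ) • t) * conj (g (x - (1 / 2 : ℝ) • t))) * hchar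

theorem integral_comp_linearMap {E : Type*} [NormedAddCommGroup E] [NormedSpace ℝ E]
    {L : V →ₗ[ℝ] V} (hL : LinearMap.det L ≠ 0) (g : V → E) :
    ∫ v, g (L v) = |(LinearMap.det L)⁻¹| • ∫ v, g v := by
  have hemb : MeasurableEmbedding L :=
    (L.equivOfDetNeZero hL).toContinuousLinearEquiv.toHomeomorph.measurableEmbedding
  rw [← hemb.integral_map, Measure.map_linearMap_addHaar_eq_smul_addHaar volume hL,
    integral_smul_measure, ENNReal.toReal_ofReal (abs_nonneg _)]

theorem memLp_comp_linearMap {L : V →ₗ[ℝ] V} (hL : LinearMap.det L ≠ 0) {f : V → ℂ} {p : ENNReal}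
    (hf : MemLp f p) : MemLp (f ∘ L) p := by
  refine MemLp.comp_of_map ?_ L.continuous_of_finiteDimensional.aemeasurable
  rw [Measure.map_linearMap_addHaar_eq_smul_addHaar volume hL]
  exact hf.smul_measure ENNReal.ofReal_ne_top

theorem wigner_comp_linearMap {L : V →ₗ[ℝ] V} (hL : LinearMap.det L ≠ 0) (f g : V → ℂ) (x ζ : V) :
    wigner (f ∘ L) (g ∘ L) x (L.adjoint ζ) = |(LinearMap.det L)⁻¹| * wigner f g (L x) ζ := by
  simp only [wigner, Real.fourier_eq]
  rw [← Complex.real_smul, ← integral_comp_linearMap hL]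
  simp only [LinearMap.adjoint_inner_right, Function.comp_apply, map_add, map_sub, map_smul]

theorem wigner_comp_linearIsometryEquiv (T : V' ≃ₗᵢ[ℝ] V) (f g : V → ℂ) (x ξ : V') :
    wigner (f ∘ T) (g ∘ T) x ξ = wigner f g (T x) (T ξ) := by
  simp only [wigner, ← Real.fourier_comp_linearIsometry]
  simp only [Function.comp_def, map_add, map_sub, map_smul]

end Covariance

section Diagonal

variable {ι : Type*} [Fintype ι] [DecidableEq ι]

/-- The linear map of `ℝ^ι` that multiplies the coordinate `i` by `c i`. -/
noncomputable def diagonalMap (c : ι → ℝ) : EuclideanSpace ℝ ι →ₗ[ℝ] EuclideanSpace ℝ ι :=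
  (Matrix.diagonal c).toEuclideanLin

theorem diagonalMap_apply (c : ι → ℝ) (x : EuclideanSpace ℝ ι) (i : ι) :
    diagonalMap c x i = c i * x i :=
  Matrix.mulVec_diagonal c x.ofLp i

theorem isSymmetric_diagonalMap (c : ι → ℝ) : (diagonalMap c).IsSymmetric :=
  Matrix.isSymmetric_toEuclideanLin_iff.2 (Matrix.isHermitian_diagonal c)

theorem adjoint_diagonalMap (c : ι → ℝ) : (diagonalMap c).adjoint = diagonalMap c :=
  (LinearMap.isSymmetric_iff_isSelfAdjoint _).1 (isSymmetric_diagonalMap c)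

theorem det_diagonalMap (c : ι → ℝ) : LinearMap.det (diagonalMap c) = ∏ i, c i := by
  rw [diagonalMap, LinearMap.det_toLpLin, Matrix.det_diagonal]

theorem inner_diagonalMap_self (c : ι → ℝ) (x : EuclideanSpace ℝ ι) :
    ⟪diagonalMap c x, x⟫ = ∑ i, c i * x i ^ 2 := by
  simp only [PiLp.inner_apply, diagonalMap_apply, RCLike.inner_apply, conj_trivial]
  exact Finset.sum_congr rfl fun i _ => by ring

theorem norm_diagonalMap_sq (c : ι → ℝ) (x : EuclideanSpace ℝ ι) :
    ‖diagonalMap c x‖ ^ 2 = ∑ i, c i ^ 2 * x i ^ 2 := by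
  simp only [EuclideanSpace.real_norm_sq_eq, diagonalMap_apply, mul_pow]

theorem sq_mul_inner_single_sq_le (c : ι → ℝ) (i : ι) (x : EuclideanSpace ℝ ι) :
    c i ^ 2 * ⟪EuclideanSpace.single i 1, x⟫ ^ 2 ≤ ‖diagonalMap c x‖ ^ 2 := by
  rw [norm_diagonalMap_sq, EuclideanSpace.inner_single_left, map_one, one_mul]
  exact Finset.single_le_sum (f := fun k => c k ^ 2 * x k ^ 2) (fun k _ => by positivity)
    (Finset.mem_univ i)

end Diagonal

section Splitting

variable {d : ℕ} (J : Finset (Fin d))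

theorem norm_coords_sq (x : EuclideanSpace ℝ (Fin d)) : ‖coords J x‖ ^ 2 = ∑ j ∈ J, x j ^ 2 := by
  rw [EuclideanSpace.real_norm_sq_eq, ← Finset.sum_coe_sort J]
  rfl

/-- The isometry `x ↦ (x_J, x_{Jᶜ})` from `ℝᵈ` onto `ℝ^J × ℝ^{Jᶜ}`. -/
noncomputable def splitCoords : EuclideanSpace ℝ (Fin d) ≃ₗᵢ[ℝ]
    WithLp 2 (EuclideanSpace ℝ J × EuclideanSpace ℝ (Jᶜ : Finset (Fin d))) where
  toFun x := WithLp.toLp 2 (coords J x, coords Jᶜ x)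
  invFun z := WithLp.toLp 2 fun j =>
    if hj : j ∈ J then z.fst ⟨j, hj⟩ else z.snd ⟨j, Finset.mem_compl.2 hj⟩
  map_add' _ _ := rfl
  map_smul' _ _ := rfl
  left_inv x := by
    ext j
    exact (dite_eq_ite (b := x j)).trans (ite_self _)
  right_inv z := by
    refine WithLp.ofLp_injective 2 (Prod.ext ?_ ?_) <;> ext j
    · exact dif_pos j.2
    · exact dif_neg (Finset.mem_compl.1 j.2)
  norm_map' x := by
    refine (sq_eq_sq₀ (norm_nonneg _) (norm_nonneg _)).1 ?_
    rw [EuclideanSpace.real_norm_sq_eq x, ← Finset.sum_add_sum_compl J, ← norm_coords_sq,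
      ← norm_coords_sq]
    exact WithLp.prod_norm_sq_eq_of_L2 _

theorem coords_splitCoords_symm
    (z : WithLp 2 (EuclideanSpace ℝ J × EuclideanSpace ℝ (Jᶜ : Finset (Fin d)))) :
    coords J ((splitCoords J).symm z) = z.fst :=
  congrArg WithLp.fst ((splitCoords J).apply_symm_apply z)

theorem coords_compl_splitCoords_symm
    (z : WithLp 2 (EuclideanSpace ℝ J × EuclideanSpace ℝ (Jᶜ : Finset (Fin d)))) :
    coords Jᶜ ((splitCoords J).symm z) = z.snd :=
  congrArg WithLp.snd ((splitCoords J).apply_symm_apply z)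

theorem coords_diagonalMap (c : Fin d → ℝ) (x : EuclideanSpace ℝ (Fin d)) :
    coords J (diagonalMap c x) = diagonalMap (fun j : J => c j) (coords J x) := by
  ext j
  exact (diagonalMap_apply c x j).trans (diagonalMap_apply (fun j : J => c j) (coords J x) j).symm

variable {J}

theorem splitCoords_symm_apply_of_mem {j : Fin d} (hj : j ∈ J) (x : EuclideanSpace ℝ J)
    (y : EuclideanSpace ℝ (Jᶜ : Finset (Fin d))) :
    (splitCoords J).symm (WithLp.toLp 2 (x, y)) j = x ⟨j, hj⟩ :=
  dif_pos hj

theorem splitCoords_symm_apply_of_notMem {j : Fin d} (hj : j ∉ J) (x : EuclideanSpace ℝ J)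
    (y : EuclideanSpace ℝ (Jᶜ : Finset (Fin d))) :
    (splitCoords J).symm (WithLp.toLp 2 (x, y)) j = y ⟨j, Finset.mem_compl.2 hj⟩ :=
  dif_neg hj

end Splitting

section FractionalFourier

variable {d : ℕ}

theorem mem_sinIdx {θ : Fin d → ℝ} {j : Fin d} : j ∈ sinIdx θ ↔ Real.sin (θ j) ≠ 0 :=
  Finset.mem_filter_univ j

theorem sin_eq_zero_of_notMem_sinIdx {θ : Fin d → ℝ} {j : Fin d} (hj : j ∉ sinIdx θ) :
    Real.sin (θ j) = 0 :=
  not_not.1 fun h => hj (mem_sinIdx.2 h)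

theorem fracMatrix_inv_mulVec (θ x ξ : Fin d → ℝ) :
    (fracMatrix θ)⁻¹.mulVec (Sum.elim x ξ) =
      Sum.elim (fun j => Real.cos (θ j) * x j - Real.sin (θ j) * ξ j)
        (fun j => Real.sin (θ j) * x j + Real.cos (θ j) * ξ j) := by
  have hdet : IsUnit (fracMatrix θ).det := SymplecticGroup.symplectic_det (fracMatrix_mem θ)
  have hrot : (fracMatrix θ).mulVec
      (Sum.elim (fun j => Real.cos (θ j) * x j - Real.sin (θ j) * ξ j)
        (fun j => Real.sin (θ j) * x j + Real.cos (θ j) * ξ j)) = Sum.elim x ξ := by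
    rw [fracMatrix, Matrix.fromBlocks_mulVec]
    ext (j | j) <;> simp only [Sum.elim_comp_inl, Sum.elim_comp_inr, Sum.elim_inl, Sum.elim_inr,
      Pi.add_apply, Matrix.neg_mulVec, Pi.neg_apply, Matrix.mulVec_diagonal]
    · linear_combination x j * Real.sin_sq_add_cos_sq (θ j)
    · linear_combination ξ j * Real.sin_sq_add_cos_sq (θ j)
  rw [← hrot, Matrix.mulVec_mulVec, Matrix.nonsing_inv_mul _ hdet, Matrix.one_mulVec]

theorem wigner_fracFourier {θ : Fin d → ℝ} {U : L2 d ≃ₗᵢ[ℂ] L2 d} (hU : IsFracFourier θ U)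
    (f g : L2 d) (x ξ : EuclideanSpace ℝ (Fin d)) :
    wigner (U f) (U g) x ξ = wigner f g
      (WithLp.toLp 2 fun j => Real.cos (θ j) * x j - Real.sin (θ j) * ξ j)
      (WithLp.toLp 2 fun j => Real.sin (θ j) * x j + Real.cos (θ j) * ξ j) := by
  have h := hU f g (Sum.elim x.ofLp ξ.ofLp)
  simp only [fracSymplectic, fracMatrix_inv_mulVec, crossWigner_eq_wigner] at h
  exact h

/-- The quadratic form `x ↦ ∑ cot θ_j x_j²` as a diagonal map. Since `Real.cot` is `cos / sin` with
`x / 0 = 0`, it ignores the coordinates with `sin θ_j = 0`. -/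
noncomputable def cotMap (θ : Fin d → ℝ) :
    EuclideanSpace ℝ (Fin d) →ₗ[ℝ] EuclideanSpace ℝ (Fin d) :=
  diagonalMap fun j => Real.cot (θ j)

/-- The factor `sin θ_j` by which the fractional Fourier transform rescales the coordinate `j`, or
the sign `cos θ_j = ±1` where it only reflects. -/
noncomputable def fracScale (θ : Fin d → ℝ) (j : Fin d) : ℝ :=
  if j ∈ sinIdx θ then Real.sin (θ j) else Real.cos (θ j)

theorem fracScale_ne_zero (θ : Fin d → ℝ) (j : Fin d) : fracScale θ j ≠ 0 := by
  rw [fracScale]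
  split_ifs with hj
  · exact mem_sinIdx.1 hj
  · intro hcos
    have := Real.sin_sq_add_cos_sq (θ j)
    simp [hcos, sin_eq_zero_of_notMem_sinIdx hj] at this

theorem det_diagonalMap_fracScale_ne_zero (θ : Fin d → ℝ) :
    LinearMap.det (diagonalMap (fracScale θ)) ≠ 0 := by
  rw [det_diagonalMap]
  exact Finset.prod_ne_zero_iff.2 fun j _ => fracScale_ne_zero θ j

/-- The function `f` multiplied by `exp (πi ∑ cot θ_j x_j²)`, in the coordinates `(x_J, x_{Jᶜ})`.
Together with `unchirpedOutput` it trades the fractional Fourier transform for the Fourier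
transform in `x_J`. -/
noncomputable def chirpedInput (θ : Fin d → ℝ) (f : EuclideanSpace ℝ (Fin d) → ℂ) :
    WithLp 2 (EuclideanSpace ℝ (sinIdx θ) × EuclideanSpace ℝ ((sinIdx θ)ᶜ : Finset (Fin d))) → ℂ :=
  chirp (cotMap θ) f ∘ (splitCoords (sinIdx θ)).symm

/-- The function `g` multiplied by `exp (-πi ∑ cot θ_j ξ_j²)` and then rescaled by `fracScale θ`,
in the coordinates `(ξ_J, ξ_{Jᶜ})`. -/
noncomputable def unchirpedOutput (θ : Fin d → ℝ) (g : EuclideanSpace ℝ (Fin d) → ℂ) :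
    WithLp 2 (EuclideanSpace ℝ (sinIdx θ) × EuclideanSpace ℝ ((sinIdx θ)ᶜ : Finset (Fin d))) → ℂ :=
  (chirp (-cotMap θ) g ∘ diagonalMap (fracScale θ)) ∘ (splitCoords (sinIdx θ)).symm

variable (θ : Fin d → ℝ)

theorem stronglyMeasurable_chirpedInput {f : EuclideanSpace ℝ (Fin d) → ℂ}
    (hf : StronglyMeasurable f) : StronglyMeasurable (chirpedInput θ f) :=
  (stronglyMeasurable_chirp _ hf).comp_measurable
    (splitCoords (sinIdx θ)).symm.continuous.measurable

theorem stronglyMeasurable_unchirpedOutput {g : EuclideanSpace ℝ (Fin d) → ℂ}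
    (hg : StronglyMeasurable g) : StronglyMeasurable (unchirpedOutput θ g) :=
  ((stronglyMeasurable_chirp _ hg).comp_measurable
    (diagonalMap _).continuous_of_finiteDimensional.measurable).comp_measurable
    (splitCoords (sinIdx θ)).symm.continuous.measurable

theorem memLp_chirpedInput {f : EuclideanSpace ℝ (Fin d) → ℂ} {p : ENNReal} (hf : MemLp f p) :
    MemLp (chirpedInput θ f) p :=
  (memLp_chirp _ hf).comp_measurePreserving (splitCoords (sinIdx θ)).symm.measurePreserving

theorem memLp_unchirpedOutput {g : EuclideanSpace ℝ (Fin d) → ℂ} {p : ENNReal} (hg : MemLp g p) :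
    MemLp (unchirpedOutput θ g) p :=
  (memLp_comp_linearMap (det_diagonalMap_fracScale_ne_zero θ)
    (memLp_chirp _ hg)).comp_measurePreserving (splitCoords (sinIdx θ)).symm.measurePreserving

theorem ae_eq_zero_of_chirpedInput_ae_eq_zero {f : EuclideanSpace ℝ (Fin d) → ℂ}
    (h : chirpedInput θ f =ᵐ[volume] 0) : f =ᵐ[volume] 0 := by
  filter_upwards [(splitCoords (sinIdx θ)).measurePreserving.quasiMeasurePreserving.ae h] with x hx
  rw [chirpedInput, Function.comp_apply, LinearIsometryEquiv.symm_apply_apply] at hx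
  rw [Pi.zero_apply, ← norm_eq_zero, ← norm_chirp (cotMap θ), hx, Pi.zero_apply, norm_zero]

theorem ae_norm_chirpedInput_le {f : EuclideanSpace ℝ (Fin d) → ℂ}
    {α : EuclideanSpace ℝ ((sinIdx θ)ᶜ : Finset (Fin d)) → ℝ} {a : ℝ}
    (hf : ∀ᵐ x, ‖f x‖ ≤ α (coords (sinIdx θ)ᶜ x) * Real.exp (-π * a * ‖coords (sinIdx θ) x‖ ^ 2)) :
    ∀ᵐ z, ‖chirpedInput θ f z‖ ≤ α z.snd * Real.exp (-π * a * ‖z.fst‖ ^ 2) := by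
  filter_upwards [(splitCoords (sinIdx θ)).symm.measurePreserving.quasiMeasurePreserving.ae hf]
    with z hz
  rwa [coords_splitCoords_symm, coords_compl_splitCoords_symm, ← norm_chirp (cotMap θ)] at hz

theorem coords_diagonalMap_fracScale (x : EuclideanSpace ℝ (Fin d)) :
    coords (sinIdx θ) (diagonalMap (fracScale θ) x) =
      diagonalMap (fun j : sinIdx θ => Real.sin (θ j)) (coords (sinIdx θ) x) := by
  rw [coords_diagonalMap]
  congr 2
  exact funext fun j => if_pos j.2

theorem ae_norm_unchirpedOutput_le {g : EuclideanSpace ℝ (Fin d) → ℂ}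
    {β : EuclideanSpace ℝ ((sinIdx θ)ᶜ : Finset (Fin d)) → ℝ} {b : ℝ}
    (hg : ∀ᵐ ξ, ‖g ξ‖ ≤ β (coords (sinIdx θ)ᶜ ξ) *
      Real.exp (-π * b * ‖coords (sinIdx θ) ξ‖ ^ 2)) :
    ∀ᵐ z, ‖unchirpedOutput θ g z‖ ≤
      (β ∘ diagonalMap fun j : ((sinIdx θ)ᶜ : Finset (Fin d)) => fracScale θ j) z.snd *
        Real.exp (-π * b * ‖diagonalMap (fun j : sinIdx θ => Real.sin (θ j)) z.fst‖ ^ 2) := by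
  have hscale := (Measure.LinearMap.quasiMeasurePreserving volume _
    (det_diagonalMap_fracScale_ne_zero θ)).ae hg
  filter_upwards [(splitCoords (sinIdx θ)).symm.measurePreserving.quasiMeasurePreserving.ae hscale]
    with z hz
  rwa [coords_diagonalMap_fracScale, coords_diagonalMap, coords_splitCoords_symm,
    coords_compl_splitCoords_symm, ← norm_chirp (-cotMap θ)] at hz

variable {θ}

-- The next two identities factor `S_θ⁻¹` as a shear by `cotMap θ`, a dilation by `fracScale θ`, a
-- quarter turn in the coordinates `J`, and a second shear.
theorem rotation_position_eq_splitCoords_symm {x ξ : EuclideanSpace ℝ (sinIdx θ)}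
    {y η : EuclideanSpace ℝ ((sinIdx θ)ᶜ : Finset (Fin d))} {v ζ : EuclideanSpace ℝ (Fin d)}
    (hv : v = diagonalMap (fracScale θ) ((splitCoords (sinIdx θ)).symm (WithLp.toLp 2 (x, y))))
    (hζ : diagonalMap (fracScale θ) ζ = (splitCoords (sinIdx θ)).symm (WithLp.toLp 2 (ξ, η))) :
    (WithLp.toLp 2 fun j => Real.cos (θ j) * v j - Real.sin (θ j) * (ζ + cotMap θ v) j) =
      (splitCoords (sinIdx θ)).symm (WithLp.toLp 2 (-ξ, y)) := by
  ext j
  have hζj := congrArg (fun v : EuclideanSpace ℝ (Fin d) => v j) hζ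
  have hcs := Real.sin_sq_add_cos_sq (θ j)
  simp only [hv, cotMap, PiLp.add_apply, diagonalMap_apply, Real.cot_eq_cos_div_sin] at hζj ⊢
  by_cases hj : j ∈ sinIdx θ
  · have hsin := mem_sinIdx.1 hj
    simp only [fracScale, if_pos hj, splitCoords_symm_apply_of_mem hj, PiLp.neg_apply] at hζj ⊢
    field_simp
    linear_combination -hζj
  · have hsin := sin_eq_zero_of_notMem_sinIdx hj
    simp only [fracScale, if_neg hj, splitCoords_symm_apply_of_notMem hj, hsin] at hcs ⊢
    linear_combination y ⟨j, Finset.mem_compl.2 hj⟩ * hcs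

theorem rotation_momentum_eq_splitCoords_symm_sub {x ξ : EuclideanSpace ℝ (sinIdx θ)}
    {y η : EuclideanSpace ℝ ((sinIdx θ)ᶜ : Finset (Fin d))} {v ζ : EuclideanSpace ℝ (Fin d)}
    (hv : v = diagonalMap (fracScale θ) ((splitCoords (sinIdx θ)).symm (WithLp.toLp 2 (x, y))))
    (hζ : diagonalMap (fracScale θ) ζ = (splitCoords (sinIdx θ)).symm (WithLp.toLp 2 (ξ, η))) :
    (WithLp.toLp 2 fun j => Real.sin (θ j) * v j + Real.cos (θ j) * (ζ + cotMap θ v) j) =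
      (splitCoords (sinIdx θ)).symm (WithLp.toLp 2 (x, η)) -
        cotMap θ ((splitCoords (sinIdx θ)).symm (WithLp.toLp 2 (-ξ, y))) := by
  ext j
  have hζj := congrArg (fun v : EuclideanSpace ℝ (Fin d) => v j) hζ
  have hcs := Real.sin_sq_add_cos_sq (θ j)
  simp only [hv, cotMap, PiLp.add_apply, PiLp.sub_apply, diagonalMap_apply,
    Real.cot_eq_cos_div_sin] at hζj ⊢
  by_cases hj : j ∈ sinIdx θ
  · have hsin := mem_sinIdx.1 hj
    simp only [fracScale, if_pos hj, splitCoords_symm_apply_of_mem hj, PiLp.neg_apply] at hζj ⊢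
    field_simp
    linear_combination x ⟨j, hj⟩ * Real.sin (θ j) * hcs + Real.cos (θ j) * hζj
  · have hsin := sin_eq_zero_of_notMem_sinIdx hj
    simp only [fracScale, if_neg hj, splitCoords_symm_apply_of_notMem hj, hsin] at hζj ⊢
    linear_combination hζj

theorem isPartialFourier_chirpedInput_unchirpedOutput {U : L2 d ≃ₗᵢ[ℂ] L2 d}
    (hU : IsFracFourier θ U) (f : L2 d) :
    IsPartialFourier (|(LinearMap.det (diagonalMap (fracScale θ)))⁻¹| : ℝ)
      (chirpedInput θ f) (unchirpedOutput θ (U f)) := by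
  intro x ξ y η
  have hdet := det_diagonalMap_fracScale_ne_zero θ
  obtain ⟨ζ, hζ⟩ : ∃ ζ, diagonalMap (fracScale θ) ζ =
      (splitCoords (sinIdx θ)).symm (WithLp.toLp 2 (ξ, η)) :=
    ((diagonalMap (fracScale θ)).equivOfDetNeZero hdet).surjective _
  have hcot : (cotMap θ).IsSymmetric := isSymmetric_diagonalMap _
  have hcot' : (-cotMap θ).IsSymmetric := fun v w => by
    rw [LinearMap.neg_apply, LinearMap.neg_apply, inner_neg_left, inner_neg_right, hcot]
  have hdilate := wigner_comp_linearMap hdet (chirp (-cotMap θ) (U f)) (chirp (-cotMap θ) (U f))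
    ((splitCoords (sinIdx θ)).symm (WithLp.toLp 2 (x, y))) ζ
  rw [adjoint_diagonalMap, hζ, wigner_chirp hcot', LinearMap.neg_apply, sub_neg_eq_add,
    wigner_fracFourier hU, rotation_position_eq_splitCoords_symm rfl hζ,
    rotation_momentum_eq_splitCoords_symm_sub rfl hζ] at hdilate
  rw [chirpedInput, unchirpedOutput, wigner_comp_linearIsometryEquiv,
    wigner_comp_linearIsometryEquiv, hdilate, wigner_chirp hcot]

theorem mul_mul_sin_sq_le_one {U : L2 d ≃ₗᵢ[ℂ] L2 d} (hU : IsFracFourier θ U) {a b : ℝ}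
    (ha : 0 < a) (hb : 0 < b) {f : L2 d} (hf : f ≠ 0)
    {α β : EuclideanSpace ℝ ((sinIdx θ)ᶜ : Finset (Fin d)) → ℝ}
    (hα : ∀ᵐ x, ‖f x‖ ≤ α (coords (sinIdx θ)ᶜ x) *
      Real.exp (-π * a * ‖coords (sinIdx θ) x‖ ^ 2))
    (hβ : ∀ᵐ ξ, ‖U f ξ‖ ≤ β (coords (sinIdx θ)ᶜ ξ) *
      Real.exp (-π * b * ‖coords (sinIdx θ) ξ‖ ^ 2)) (j : Fin d) :
    a * b * Real.sin (θ j) ^ 2 ≤ 1 := by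
  by_contra! hj
  have hsin : j ∈ sinIdx θ := mem_sinIdx.2 fun h => by norm_num [h] at hj
  have hGle : ∀ᵐ z, ‖unchirpedOutput θ (U f) z‖ ≤
      (β ∘ diagonalMap fun j : ((sinIdx θ)ᶜ : Finset (Fin d)) => fracScale θ j) z.snd *
        Real.exp (-π * (b * Real.sin (θ j) ^ 2) *
          ⟪EuclideanSpace.single (⟨j, hsin⟩ : sinIdx θ) (1 : ℝ), z.fst⟫ ^ 2) := by
    filter_upwards [ae_norm_unchirpedOutput_le θ hβ] with z hz
    refine hz.trans (mul_le_mul_of_nonneg_left (Real.exp_le_exp.2 ?_)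
      (nonneg_of_mul_nonneg_left ((norm_nonneg _).trans hz) (Real.exp_pos _)))
    have hcoord := sq_mul_inner_single_sq_le (fun k : sinIdx θ => Real.sin (θ k)) ⟨j, hsin⟩ z.fst
    have hrate := mul_le_mul_of_nonneg_left hcoord (mul_pos Real.pi_pos hb).le
    linarith
  refine hf ((Lp.eq_zero_iff_ae_eq_zero).2 (ae_eq_zero_of_chirpedInput_ae_eq_zero θ ?_))
  exact ae_eq_zero_of_partialFourier_gaussian_bounds
    (by simpa using det_diagonalMap_fracScale_ne_zero θ)
    (stronglyMeasurable_unchirpedOutput θ (Lp.stronglyMeasurable (U f)))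
    (stronglyMeasurable_chirpedInput θ (Lp.stronglyMeasurable f))
    (memLp_unchirpedOutput θ (Lp.memLp (U f))) (memLp_chirpedInput θ (Lp.memLp f))
    (isPartialFourier_chirpedInput_unchirpedOutput hU f) ha
    (mul_assoc a b _ ▸ hj) (by simp) (ae_norm_chirpedInput_le θ hα) hGle

theorem inner_cotMap_self (θ : Fin d → ℝ) (x : EuclideanSpace ℝ (Fin d)) :
    ⟪cotMap θ x, x⟫ = ∑ j ∈ sinIdx θ, Real.cot (θ j) * x j ^ 2 := by
  rw [cotMap, inner_diagonalMap_self]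
  refine (Finset.sum_subset (Finset.subset_univ _) fun j _ hj => ?_).symm
  rw [Real.cot_eq_cos_div_sin, sin_eq_zero_of_notMem_sinIdx hj, div_zero, zero_mul]

theorem fourierChar_neg_cotMap_mul_exp (θ : Fin d → ℝ) (a : ℝ) (x : EuclideanSpace ℝ (Fin d)) :
    (𝐞 (1 / 2 * ⟪(-cotMap θ) x, x⟫) : ℂ) * Real.exp (-π * a * ‖coords (sinIdx θ) x‖ ^ 2) =
      ∏ j ∈ sinIdx θ, cexp (-π * (a + I * Real.cot (θ j)) * (x j : ℂ) ^ 2) := by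
  rw [Real.fourierChar_apply, ofReal_exp, ← Complex.exp_add, ← Complex.exp_sum, norm_coords_sq,
    LinearMap.neg_apply, inner_neg_left, inner_cotMap_self]
  push_cast
  rw [← Finset.sum_neg_distrib]
  simp only [Finset.mul_sum, Finset.sum_mul, ← Finset.sum_add_distrib]
  exact congrArg cexp (Finset.sum_congr rfl fun j _ => by ring)

theorem exists_memLp_two_ae_eq_mul_prod_cexp {U : L2 d ≃ₗᵢ[ℂ] L2 d} (hU : IsFracFourier θ U)
    {a b : ℝ} (ha : 0 < a) (hb : 0 < b) {f : L2 d} (hf : f ≠ 0)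
    {α β : EuclideanSpace ℝ ((sinIdx θ)ᶜ : Finset (Fin d)) → ℝ}
    (hα : ∀ᵐ x, ‖f x‖ ≤ α (coords (sinIdx θ)ᶜ x) *
      Real.exp (-π * a * ‖coords (sinIdx θ) x‖ ^ 2))
    (hβ : ∀ᵐ ξ, ‖U f ξ‖ ≤ β (coords (sinIdx θ)ᶜ ξ) *
      Real.exp (-π * b * ‖coords (sinIdx θ) ξ‖ ^ 2))
    (hcrit : ∀ j ∈ sinIdx θ, Real.sin (θ j) ^ 2 = 1 / (a * b)) :
    ∃ γ : EuclideanSpace ℝ ((sinIdx θ)ᶜ : Finset (Fin d)) → ℂ, MemLp γ 2 ∧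
      ∀ᵐ x, f x = γ (coords (sinIdx θ)ᶜ x) *
        ∏ j ∈ sinIdx θ, cexp (-π * (a + I * Real.cot (θ j)) * (x j : ℂ) ^ 2) := by
  have hGle : ∀ᵐ z, ‖unchirpedOutput θ (U f) z‖ ≤
      (β ∘ diagonalMap fun j : ((sinIdx θ)ᶜ : Finset (Fin d)) => fracScale θ j) z.snd *
        Real.exp (-π / a * ‖z.fst‖ ^ 2) := by
    filter_upwards [ae_norm_unchirpedOutput_le θ hβ] with z hz
    have hnorm : b * ‖diagonalMap (fun j : sinIdx θ => Real.sin (θ j)) z.fst‖ ^ 2 =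
        ‖z.fst‖ ^ 2 / a := by
      rw [norm_diagonalMap_sq, Finset.sum_congr rfl fun j _ => by rw [hcrit j j.2],
        ← Finset.mul_sum, ← EuclideanSpace.real_norm_sq_eq]
      field_simp
    rwa [mul_assoc, hnorm, mul_div_assoc', ← div_mul_eq_mul_div] at hz
  obtain ⟨γ, hγ, hfγ⟩ := exists_memLp_two_ae_eq_mul_gaussian
    (by simpa using det_diagonalMap_fracScale_ne_zero θ)
    (stronglyMeasurable_unchirpedOutput θ (Lp.stronglyMeasurable (U f)))
    (stronglyMeasurable_chirpedInput θ (Lp.stronglyMeasurable f))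
    (memLp_unchirpedOutput θ (Lp.memLp (U f))) (memLp_chirpedInput θ (Lp.memLp f))
    (fun h => hf ((Lp.eq_zero_iff_ae_eq_zero).2 (ae_eq_zero_of_chirpedInput_ae_eq_zero θ h)))
    (isPartialFourier_chirpedInput_unchirpedOutput hU f) ha (ae_norm_chirpedInput_le θ hα) hGle
  refine ⟨γ, hγ, ?_⟩
  filter_upwards [(splitCoords (sinIdx θ)).measurePreserving.quasiMeasurePreserving.ae hfγ]
    with x hx
  rw [chirpedInput, Function.comp_apply, LinearIsometryEquiv.symm_apply_apply] at hx
  rw [← fourierChar_neg_cotMap_mul_exp, ← chirp_neg_chirp (cotMap θ) f, chirp, hx,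
    Circle.smul_def, smul_eq_mul, mul_left_comm]
  rfl

end FractionalFourier

end FracFourierHardy

theorem mainTheorem7 {d : ℕ} (θ : Fin d → ℝ) (hθ : ∃ j, Real.sin (θ j) ≠ 0)
    (U : L2 d ≃ₗᵢ[ℂ] L2 d) (hU : IsFracFourier θ U)
    (a b : ℝ) (ha : 0 < a) (hb : 0 < b)
    (f : L2 d) (hf : f ≠ 0)
    (α β : EuclideanSpace ℝ ((sinIdx θ)ᶜ : Finset (Fin d)) → ℝ)
    (hα : ∀ y, 0 < α y) (hβ : ∀ y, 0 < β y)
    (hdecay : ∀ᵐ x : EuclideanSpace ℝ (Fin d),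
      ‖f x‖ ≤ α (coords (sinIdx θ)ᶜ x) * Real.exp (-Real.pi * a * ‖coords (sinIdx θ) x‖ ^ 2))
    (hdecay' : ∀ᵐ ξ : EuclideanSpace ℝ (Fin d),
      ‖U f ξ‖ ≤ β (coords (sinIdx θ)ᶜ ξ) * Real.exp (-Real.pi * b * ‖coords (sinIdx θ) ξ‖ ^ 2)) :
    (∀ j, a * b * Real.sin (θ j) ^ 2 ≤ 1) ∧
    ((∀ j ∈ sinIdx θ, Real.sin (θ j) ^ 2 = 1 / (a * b)) →
      ∃ γ : EuclideanSpace ℝ ((sinIdx θ)ᶜ : Finset (Fin d)) → ℂ,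
        MemLp γ 2 volume ∧
        ∀ᵐ x : EuclideanSpace ℝ (Fin d),
          f x = γ (coords (sinIdx θ)ᶜ x) *
            ∏ j ∈ sinIdx θ, Complex.exp
              (-Real.pi * ((a : ℂ) + Complex.I * (Real.cot (θ j) : ℂ)) * ((x j : ℝ) : ℂ) ^ 2)) :=
  ⟨fun j => mul_mul_sin_sq_le_one hU ha hb hf hdecay hdecay' j,
    fun hcrit => exists_memLp_two_ae_eq_mul_prod_cexp hU ha hb hf hdecay hdecay' hcrit⟩
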